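/- Let $d\ge 1$, $T>0$, $H\in(1/2,1)$, $\alpha_H=H(2H-1)$. Let $\mathcal D=\mathcal D((0,T)\times\mathbb R^d)$ be the space of real $C^\infty$ functions with compact support contained in $(0,T)\times\mathbb R^d$, put $$\langle\varphi,\psi\rangle_{\mathcal H}=\alpha_H\int_0^T\!\int_0^T\!\int_{\mathbb R^d}\varphi(u,x)\,|u-v|^{2H-2}\,\psi(v,x)\,dx\,dv\,du ,\qquad \|\varphi\|_{\mathcal H}^2=\langle\varphi,\varphi\rangle_{\mathcal H},$$ and let $|\mathcal H|$ be the class of measurable $\varphi$ with $\int_0^T\int_0^T\int_{\mathbb R^d}|\varphi(u,x)||\varphi(v,x)||u-v|^{2H-2}\,dx\,dv\,du<\infty$. Let $F=\{F(\varphi):\varphi\in\mathcal D\}$ be a zero-mean Gaussian process on a probability space $(\Omega,P)$ with $E[F(\varphi)F(\psi)]=\langle\varphi,\psi\rangle_{\mathcal H}$ (noise that is fractional in time and white in space). For $\varphi\in|\mathcal H|$, the stochastic integral $F(\varphi)$ is the $L^2(\Omega)$-limit of $F(\varphi_n)$ for test functions $\varphi_n\in\mathcal D$ with $\|\varphi_n-\varphi\|_{\mathcal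 H}\to0$. Let $G(t,x)=(4\pi t)^{-d/2}e^{-|x|^2/(4t)}$ for $t>0$ and $G(t,x)=0$ for $t\le0$, let $g_{tx}(s,y)=G(t-s,x-y)$, and for $\eta\in\mathcal D$ let $(\eta*\tilde G)(t,x)=\int_0^\infty\int_{\mathbb R^d}\eta(t+s,x+y)\,G(s,y)\,dy\,ds$. Consider the heat equation $v_t-\Delta v=\dot F$ on $(0,T)\times\mathbb R^d$, $v(0,\cdot)=0$. (a) For every $\eta\in\mathcal D$ the random variable $v(\eta):=F(\eta*\tilde G)$ (the distribution-valued solution) is well defined up to a.s. equality. (b) There exists a jointly measurable process $Y=\{Y(t,x):t\in[0,T],x\in\mathbb R^d\}$, with $E|Y(t,x)|^2$ bounded on each compact subset of $[0,T]\times\mathbb R^d$, such that for every $\eta\in\mathcal D$, almost surely, $$v(\eta)=\int_0^T\int_{\mathbb R^d}Y(t,x)\,\eta(t,x)\,dx\,dt, \tag{1}$$ if and only if $H>d/4$. The condition $H>d/4$ forces $d\le3$. (c) If $H>d/4$, then the process solution $v(t,x):=F(g_{tx})$ is well defined up to a.s. equality for every $(t,x)\in[0,T]\times\mathbb R^d$;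 there is a process $Y$ as in (b) that is a modification of it, i.e. $Y(t,x)=v(t,x)$ a.s. for every $(t,x)\in[0,T]\times\mathbb R^d$; and every process $Y$ as in (b) satisfies $Y(t,x)=v(t,x)$ a.s. for Lebesgue-almost every $(t,x)\in[0,T]\times\mathbb R^d$. -/

import Mathlib

open MeasureTheory ProbabilityTheory Filter Topology Set
open scoped ENNReal

namespace FracHeat

/-- Space-time `ℝ × ℝ^d`, with Lebesgue measure as its `volume`. -/
abbrev SpaceTime (d : ℕ) : Type := ℝ × EuclideanSpace ℝ (Fin d)

/-- The open set `(0,T) × ℝ^d`. -/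
def openStrip (d : ℕ) (T : ℝ) : TopologicalSpace.Opens (SpaceTime d) :=
  ⟨Ioo 0 T ×ˢ univ, isOpen_Ioo.prod isOpen_univ⟩

/-- The set `[0,T] × ℝ^d`. -/
def closedStrip (d : ℕ) (T : ℝ) : Set (SpaceTime d) := Icc 0 T ×ˢ univ

/-- `𝒟((0,T) × ℝ^d)`: the real `C^∞` functions on `ℝ × ℝ^d` with compact support contained in
`(0,T) × ℝ^d`. -/
abbrev TestFn (d : ℕ) (T : ℝ) : Type := TestFunction (openStrip d T) ℝ (⊤ : ℕ∞)

/-- The inner product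
`⟨φ,ψ⟩_𝓗 = α_H ∫₀ᵀ ∫₀ᵀ ∫_{ℝ^d} φ(u,x) |u-v|^{2H-2} ψ(v,x) dx dv du`, with `α_H = H(2H-1)`. -/
noncomputable def innerH {d : ℕ} (H T : ℝ) (φ ψ : SpaceTime d → ℝ) : ℝ :=
  H * (2 * H - 1) * ∫ u in Icc 0 T, ∫ v in Icc 0 T, ∫ x : EuclideanSpace ℝ (Fin d),
    φ (u, x) * |u - v| ^ (2 * H - 2) * ψ (v, x)

/-- The class `|𝓗|` of measurable functions with
`∫₀ᵀ ∫₀ᵀ ∫_{ℝ^d} |φ(u,x)| |φ(v,x)| |u-v|^{2H-2} dx dv du < ∞`. -/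
def MemAbsH {d : ℕ} (H T : ℝ) (φ : SpaceTime d → ℝ) : Prop :=
  Measurable φ ∧
    ∫⁻ u in Icc 0 T, ∫⁻ v in Icc 0 T, ∫⁻ x : EuclideanSpace ℝ (Fin d),
      ‖φ (u, x)‖ₑ * ‖φ (v, x)‖ₑ * ENNReal.ofReal (|u - v| ^ (2 * H - 2)) < ∞

/-- `F` is a noise on `(0,T) × ℝ^d`, fractional in time with Hurst index `H` and white in space:
a zero-mean Gaussian process indexed by `𝒟((0,T) × ℝ^d)` with `E[F(φ)F(ψ)] = ⟨φ,ψ⟩_𝓗`. -/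
structure IsFractionalWhiteNoise {Ω : Type*} [MeasurableSpace Ω] {d : ℕ} (H T : ℝ)
    (P : Measure Ω) (F : TestFn d T → Ω → ℝ) : Prop where
  gaussian : IsGaussianProcess F P
  mean_zero : ∀ φ : TestFn d T, ∫ ω, F φ ω ∂P = 0
  covariance : ∀ φ ψ : TestFn d T, ∫ ω, F φ ω * F ψ ω ∂P = innerH H T φ ψ

/-- `X` is (a version of) the stochastic integral `F(φ) = ∫₀ᵀ ∫_{ℝ^d} φ(t,x) F(dt,dx)`.
The isometry `F` is extended from `𝒟((0,T) × ℝ^d)` to the completion `𝓗`, in which a function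
`φ ∈ |𝓗|` is the limit of test functions `φₙ` with `‖φₙ - φ‖_𝓗 → 0`; so `F(φ)` is the
`L²(Ω)`-limit of `F(φₙ)`. -/
structure IsStochIntegral {Ω : Type*} [MeasurableSpace Ω] {d : ℕ} (H T : ℝ)
    (P : Measure Ω) (F : TestFn d T → Ω → ℝ) (φ : SpaceTime d → ℝ) (X : Ω → ℝ) : Prop where
  mem_absH : MemAbsH H T φ
  memLp : MemLp X 2 P
  approx : ∃ φn : ℕ → TestFn d T,
    Tendsto (fun n => innerH H T (fun p => φn n p - φ p) (fun p => φn n p - φ p)) atTop (𝓝 0) ∧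
    Tendsto (fun n => eLpNorm (fun ω => F (φn n) ω - X ω) 2 P) atTop (𝓝 0)

/-- The stochastic integral `F(φ)` is well defined, as a random variable up to a.s. equality. -/
def StochIntegralWellDefined {Ω : Type*} [MeasurableSpace Ω] {d : ℕ} (H T : ℝ)
    (P : Measure Ω) (F : TestFn d T → Ω → ℝ) (φ : SpaceTime d → ℝ) : Prop :=
  ∃ X : Ω → ℝ, IsStochIntegral H T P F φ X ∧
    ∀ X' : Ω → ℝ, IsStochIntegral H T P F φ X' → X' =ᵐ[P] X

open Classical in
/-- A version of the stochastic integral `F(φ)` (and `0` when it does not exist). -/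
noncomputable def stochIntegral {Ω : Type*} [MeasurableSpace Ω] {d : ℕ} (H T : ℝ)
    (P : Measure Ω) (F : TestFn d T → Ω → ℝ) (φ : SpaceTime d → ℝ) : Ω → ℝ :=
  if h : ∃ X : Ω → ℝ, IsStochIntegral H T P F φ X then h.choose else 0

/-- The fundamental solution `G` of the heat equation `v_t - Δv = 0` on `ℝ^d`. -/
noncomputable def heatKernel {d : ℕ} (t : ℝ) (x : EuclideanSpace ℝ (Fin d)) : ℝ :=
  if 0 < t then (4 * Real.pi * t) ^ (-(d : ℝ) / 2) * Real.exp (-‖x‖ ^ 2 / (4 * t)) else 0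

/-- `g_{tx}(s,y) = G(t-s, x-y)`. -/
noncomputable def gKernel {d : ℕ} (t : ℝ) (x : EuclideanSpace ℝ (Fin d)) : SpaceTime d → ℝ :=
  fun p => heatKernel (t - p.1) (x - p.2)

/-- `(η * G̃)(t,x) = ∫_{ℝ₊} ∫_{ℝ^d} η(t+s, x+y) G(s,y) dy ds`. -/
noncomputable def convReflected {d : ℕ} (η : SpaceTime d → ℝ) : SpaceTime d → ℝ :=
  fun p => ∫ s in Ioi (0 : ℝ), ∫ y : EuclideanSpace ℝ (Fin d),
    η (p.1 + s, p.2 + y) * heatKernel s y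

/-- The process solution `v(t,x) = F(g_{tx})`. -/
noncomputable def processSolution {Ω : Type*} [MeasurableSpace Ω] {d : ℕ} (H T : ℝ)
    (P : Measure Ω) (F : TestFn d T → Ω → ℝ) (t : ℝ) (x : EuclideanSpace ℝ (Fin d)) : Ω → ℝ :=
  stochIntegral H T P F (gKernel t x)

/-- The distribution-valued solution `v(η) = F(η * G̃)`. -/
noncomputable def distSolution {Ω : Type*} [MeasurableSpace Ω] {d : ℕ} (H T : ℝ)
    (P : Measure Ω) (F : TestFn d T → Ω → ℝ) (η : TestFn d T) : Ω → ℝ :=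
  stochIntegral H T P F (convReflected η)

/-- `Y` is a jointly measurable process, mean-square bounded on the compact subsets of
`[0,T] × ℝ^d`, with `v(η) = ∫₀ᵀ ∫_{ℝ^d} Y(t,x) η(t,x) dx dt` a.s. for every test function `η`.
(Only the values of `Y` on `[0,T] × ℝ^d` matter; measurability is asked of its extension to
`ℝ × ℝ^d`, for instance by zero.) -/
structure RepresentsSolution {Ω : Type*} [MeasurableSpace Ω] {d : ℕ} (H T : ℝ)
    (P : Measure Ω) (F : TestFn d T → Ω → ℝ)
    (Y : ℝ → EuclideanSpace ℝ (Fin d) → Ω → ℝ) : Prop where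
  jointly_measurable : Measurable fun q : SpaceTime d × Ω => Y q.1.1 q.1.2 q.2
  locally_bounded : ∀ K : Set (SpaceTime d), IsCompact K → K ⊆ closedStrip d T →
    ∃ C : ℝ, ∀ p ∈ K, ∫⁻ ω, ‖Y p.1 p.2 ω‖ₑ ^ 2 ∂P ≤ ENNReal.ofReal C
  represents : ∀ η : TestFn d T,
    distSolution H T P F η =ᵐ[P] fun ω => ∫ p in closedStrip d T, Y p.1 p.2 ω * η p

end FracHeat

/-!
The inner product of `𝓗` has the kernel `|u - v| ^ (2H - 2)`, which is, up to a constant, the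
composition of the one-sided kernel `(u - w)₊ ^ (H - 3/2)` with its transpose
(`lintegral_fracKernel_mul`). Fractional integration in time therefore maps `|𝓗|` isometrically,
up to a constant, into `L²(ℝ × ℝ^d)` (`innerH_eq_inner`), and the noise is an isometry on the image
of the test functions. Test functions are dense in `|𝓗|` (`fracL2_mem_closure`): if `h` is
orthogonal to their fractional integrals, then the adjoint fractional integral of `h` vanishes
almost everywhere on the strip. So `F(φ)` exists, is unique and satisfies
`E[F(φ)F(ψ)] = ⟨φ,ψ⟩_𝓗` for all `φ, ψ ∈ |𝓗|`. As `η * G̃` is bounded and integrable in space,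
it belongs to `|𝓗|`, which gives the distribution-valued solution.

By the semigroup property of `G`, the energy of `g_{tx}` is a multiple of
`∫₀ᵗ∫₀ᵗ |r - s| ^ (2H - 2) (r + s) ^ (-d/2) dr ds` (`energy_gKernel`). The integrand is homogeneous
of degree `2H - 2 - d/2`, and the integral is finite exactly for `H > d/4` (`heatEnergy_lt_top`,
`heatEnergy_eq_top`).

*Sufficiency.* For `H > d/4` the process `v(t,x) = F(g_{tx})` is bounded in `L²(Ω)`. It has a jointly
measurable modification `Y` because the `𝓗`-distance of `g_p` and `g_q` depends measurably on
`p`, and `L²(ℝ × ℝ^d)` is separable (`exists_measurable_modification`). Since `η * G̃` is the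
superposition `∫ η(p) g_p dp` (`convReflected_eq`), the difference of `v(η)` and `∫ Y η` is
orthogonal to every stochastic integral, hence to itself.

*Necessity.* If `Y` represents the solution, then `‖η * G̃‖_𝓗 ^ 2 = E |∫ Y η| ^ 2` is bounded for
nonnegative `η` of integral one with support in a fixed compact set. Letting `η` concentrate at an
interior point, Fatou's lemma bounds the energy of `g_{tx}` (`RepresentsSolution.heatEnergy_lt_top`).

*Uniqueness.* The difference of two representing processes integrates to zero over all measurable
rectangles in space-time times `Ω`, so it vanishes almost everywhere
(`LocallyL2Bounded.ae_eq_zero`).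
-/

namespace FracHeat

variable {d : ℕ}

/-! ### The one-sided fractional kernel -/

/-- The one-sided fractional kernel `(u - w)₊ ^ (H - 3/2)`, a square root of `|u - v| ^ (2H - 2)`
with respect to composition. -/
noncomputable def fracKernel (H u w : ℝ) : ℝ := if w < u then (u - w) ^ (H - 3 / 2) else 0

/-- The constant `∫₀^∞ (s (1 + s)) ^ (H - 3/2) ds`, a value of the Beta function. -/
noncomputable def fracConst (H : ℝ) : ℝ≥0∞ :=
  ∫⁻ s in Ioi (0 : ℝ), ENNReal.ofReal ((s * (1 + s)) ^ (H - 3 / 2))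

lemma fracKernel_nonneg (H u w : ℝ) : 0 ≤ fracKernel H u w := by
  unfold fracKernel
  split_ifs with h
  · exact Real.rpow_nonneg (sub_nonneg.2 h.le) _
  · exact le_rfl

@[fun_prop]
lemma measurable_fracKernel (H : ℝ) : Measurable fun q : ℝ × ℝ => fracKernel H q.1 q.2 := by
  unfold fracKernel
  exact Measurable.ite (measurableSet_lt measurable_snd measurable_fst) (by fun_prop) (by fun_prop)

/-- The integrand behaves like `s ^ (H - 3/2)` at `0` and like `s ^ (2H - 3)` at infinity. -/
lemma fracConst_ne_top {H : ℝ} (hH : 1 / 2 < H) (hH' : H < 1) : fracConst H ≠ ∞ := by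
  unfold fracConst
  rw [← Ioc_union_Ioi_eq_Ioi zero_le_one, lintegral_union measurableSet_Ioi
    (Set.disjoint_left.2 fun x hx hx' => not_lt.2 hx.2 hx')]
  refine ENNReal.add_ne_top.2 ⟨ne_of_lt ?_, ne_of_lt ?_⟩
  · have h1 : IntegrableOn (fun s : ℝ => s ^ (H - 3 / 2)) (Ioc 0 1) :=
      (intervalIntegrable_iff_integrableOn_Ioc_of_le zero_le_one).1
        (intervalIntegral.intervalIntegrable_rpow' (by linarith))
    refine lt_of_le_of_lt (setLIntegral_mono' measurableSet_Ioc fun s hs => ?_)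
      h1.lintegral_lt_top
    refine ENNReal.ofReal_le_ofReal
      (Real.rpow_le_rpow_of_nonpos hs.1 ?_ (by linarith))
    nlinarith [hs.1]
  · have h1 : IntegrableOn (fun s : ℝ => s ^ (2 * (H - 3 / 2))) (Ioi 1) :=
      integrableOn_Ioi_rpow_of_lt (by linarith) one_pos
    refine lt_of_le_of_lt (setLIntegral_mono' measurableSet_Ioi fun s hs => ?_)
      h1.lintegral_lt_top
    have hs0 : (0 : ℝ) < s := lt_trans one_pos hs
    refine ENNReal.ofReal_le_ofReal ?_
    rw [Real.rpow_mul hs0.le]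
    refine Real.rpow_le_rpow_of_nonpos (by positivity) ?_ (by linarith)
    rw [Real.rpow_two]; nlinarith

lemma fracConst_ne_zero (H : ℝ) : fracConst H ≠ 0 := by
  unfold fracConst
  refine ((setLIntegral_pos_iff (by fun_prop)).2 ?_).ne'
  refine lt_of_lt_of_le ?_ (measure_mono (s := Ioi (0 : ℝ)) fun s hs => ⟨?_, hs⟩)
  · simp
  · have hs : (0 : ℝ) < s := hs
    simp only [Function.mem_support, ne_eq, ENNReal.ofReal_eq_zero, not_le]
    positivity

/-- The fractional kernel composed with its transpose is a multiple of `|u - v| ^ (2H - 2)`; the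
substitution `w = v - (u - v) s` scales the integral. -/
lemma lintegral_fracKernel_mul {H : ℝ} {u v : ℝ} (huv : u ≠ v) :
    ∫⁻ w, ENNReal.ofReal (fracKernel H u w) * ENNReal.ofReal (fracKernel H v w) =
      fracConst H * ENNReal.ofReal (|u - v| ^ (2 * H - 2)) := by
  wlog h : v < u generalizing u v
  · rw [abs_sub_comm, ← this huv.symm (lt_of_le_of_ne (not_lt.1 h) huv)]
    simp_rw [mul_comm]
  have hr : 0 < u - v := sub_pos.2 h
  have h1 : ∫⁻ w, ENNReal.ofReal (fracKernel H u w) * ENNReal.ofReal (fracKernel H v w) =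
      ∫⁻ w in Iio v, ENNReal.ofReal ((u - w) ^ (H - 3 / 2)) *
        ENNReal.ofReal ((v - w) ^ (H - 3 / 2)) := by
    rw [← lintegral_indicator measurableSet_Iio]
    refine lintegral_congr fun w => ?_
    by_cases hw : w < v
    · simp [fracKernel, hw, hw.trans h]
    · simp [fracKernel, hw]
  have himg : (fun s => v - (u - v) * s) '' Ioi 0 = Iio v := by
    ext w
    simp only [mem_image, mem_Ioi, mem_Iio]
    constructor
    · rintro ⟨s, hs, rfl⟩
      have := mul_pos hr hs
      linarith
    · intro hw
      exact ⟨(v - w) / (u - v), div_pos (by linarith) hr, by field_simp; ring⟩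
  rw [h1, ← himg, lintegral_image_eq_lintegral_abs_deriv_mul measurableSet_Ioi
    (f' := fun _ => -(u - v))
    (fun s _ => by
      have := ((hasDerivAt_id s).const_mul (u - v)).const_sub v
      simpa using this.hasDerivWithinAt)
    (fun a _ b _ hab => by
      have : (u - v) * a = (u - v) * b := by simpa using hab
      exact mul_left_cancel₀ hr.ne' this), fracConst, ← lintegral_mul_const' _ _ (by simp)]
  refine setLIntegral_congr_fun measurableSet_Ioi fun s hs => ?_
  have hs : (0 : ℝ) < s := hs
  simp only [abs_neg]
  have e1 : u - (v - (u - v) * s) = (u - v) * (1 + s) := by ring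
  have e2 : v - (v - (u - v) * s) = (u - v) * s := by ring
  rw [e1, e2, ← ENNReal.ofReal_mul (by positivity), ← ENNReal.ofReal_mul (by positivity),
    ← ENNReal.ofReal_mul (by positivity), abs_of_pos hr, Real.mul_rpow hr.le (by positivity),
    Real.mul_rpow hr.le hs.le, Real.mul_rpow hs.le (by positivity)]
  congr 1
  have : (u - v) ^ (2 * H - 2) = (u - v) * ((u - v) ^ (H - 3 / 2) * (u - v) ^ (H - 3 / 2)) := by
    rw [show 2 * H - 2 = 1 + (H - 3 / 2 + (H - 3 / 2)) by ring, Real.rpow_add hr,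
      Real.rpow_add hr, Real.rpow_one]
  rw [this]; ring

/-! ### The embedding of `|𝓗|` into `L²` -/

/-- The fractional integral `(w,x) ↦ ∫₀ᵀ f(u,x) (u - w)₊ ^ (H - 3/2) du` of a nonnegative
function. -/
noncomputable def lfrac (H T : ℝ) (f : SpaceTime d → ℝ≥0∞) (z : SpaceTime d) : ℝ≥0∞ :=
  ∫⁻ u in Icc 0 T, f (u, z.2) * ENNReal.ofReal (fracKernel H u z.1)

/-- The fractional integral `(w,x) ↦ ∫₀ᵀ φ(u,x) (u - w)₊ ^ (H - 3/2) du`. For `φ ∈ |𝓗|` the integrand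
is integrable for almost every `(w,x)`, so the default value `0` elsewhere is immaterial. -/
noncomputable def frac (H T : ℝ) (φ : SpaceTime d → ℝ) (z : SpaceTime d) : ℝ :=
  ∫ u in Icc 0 T, φ (u, z.2) * fracKernel H u z.1

/-- The bilinear energy of two nonnegative functions, without the factor `H (2H - 1)`. -/
noncomputable def energy (H T : ℝ) (f g : SpaceTime d → ℝ≥0∞) : ℝ≥0∞ :=
  ∫⁻ u in Icc 0 T, ∫⁻ v in Icc 0 T, ∫⁻ x : EuclideanSpace ℝ (Fin d),
    f (u, x) * g (v, x) * ENNReal.ofReal (|u - v| ^ (2 * H - 2))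

lemma memAbsH_iff {H T : ℝ} {φ : SpaceTime d → ℝ} :
    MemAbsH H T φ ↔ Measurable φ ∧ energy H T (fun p => ‖φ p‖ₑ) (fun p => ‖φ p‖ₑ) < ∞ :=
  Iff.rfl

lemma measurable_lfrac (H T : ℝ) {f : SpaceTime d → ℝ≥0∞} (hf : Measurable f) :
    Measurable (lfrac H T f) := by
  unfold lfrac
  refine Measurable.lintegral_prod_right' (f := fun (q : SpaceTime d × ℝ) =>
    f (q.2, q.1.2) * ENNReal.ofReal (fracKernel H q.2 q.1.1)) ?_
  have h1 : Measurable fun q : SpaceTime d × ℝ => fracKernel H q.2 q.1.1 :=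
    (measurable_fracKernel H).comp (measurable_snd.prodMk (measurable_fst.comp measurable_fst))
  fun_prop

lemma ae_fst_ne {μ : Measure ℝ} [NullSingletonClass μ] (u : ℝ) : ∀ᵐ v ∂μ, u ≠ v := by
  have : ({u} : Set ℝ)ᶜ ∈ ae μ := by simp [mem_ae_iff]
  filter_upwards [this] with v hv h
  exact hv h.symm

/-- The energy is the `L²` pairing of the fractional integrals. -/
lemma lintegral_lfrac_mul (H T : ℝ) {f g : SpaceTime d → ℝ≥0∞} (hf : Measurable f)
    (hg : Measurable g) :
    ∫⁻ z, lfrac H T f z * lfrac H T g z = fracConst H * energy H T f g := by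
  have hk1 : Measurable fun q : (SpaceTime d × ℝ) × ℝ => fracKernel H q.1.2 q.1.1.1 :=
    (measurable_fracKernel H).comp (by fun_prop : Measurable fun q : (SpaceTime d × ℝ) × ℝ =>
      ((q.1.2, q.1.1.1) : ℝ × ℝ))
  have hk2 : Measurable fun q : (SpaceTime d × ℝ) × ℝ => fracKernel H q.2 q.1.1.1 :=
    (measurable_fracKernel H).comp (by fun_prop : Measurable fun q : (SpaceTime d × ℝ) × ℝ =>
      ((q.2, q.1.1.1) : ℝ × ℝ))
  have hm : Measurable fun q : (SpaceTime d × ℝ) × ℝ =>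
      f (q.1.2, q.1.1.2) * ENNReal.ofReal (fracKernel H q.1.2 q.1.1.1) *
        (g (q.2, q.1.1.2) * ENNReal.ofReal (fracKernel H q.2 q.1.1.1)) := by fun_prop
  have hkm : ∀ u : ℝ, Measurable fun w => fracKernel H u w := fun u =>
    (measurable_fracKernel H).comp (measurable_const.prodMk measurable_id)
  have hkm' : ∀ w : ℝ, Measurable fun u => fracKernel H u w := fun w =>
    (measurable_fracKernel H).comp (measurable_id.prodMk measurable_const)
  calc ∫⁻ z, lfrac H T f z * lfrac H T g z
      = ∫⁻ z : SpaceTime d, ∫⁻ u in Icc 0 T, ∫⁻ v in Icc 0 T,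
          f (u, z.2) * ENNReal.ofReal (fracKernel H u z.1) *
            (g (v, z.2) * ENNReal.ofReal (fracKernel H v z.1)) := by
        refine lintegral_congr fun z => ?_
        have h1 := hkm' z.1
        rw [lfrac, lfrac, lintegral_lintegral_mul (by fun_prop) (by fun_prop)]
    _ = ∫⁻ u in Icc 0 T, ∫⁻ z : SpaceTime d, ∫⁻ v in Icc 0 T,
          f (u, z.2) * ENNReal.ofReal (fracKernel H u z.1) *
            (g (v, z.2) * ENNReal.ofReal (fracKernel H v z.1)) :=
        lintegral_lintegral_swap (Measurable.lintegral_prod_right hm).aemeasurable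
    _ = ∫⁻ u in Icc 0 T, ∫⁻ v in Icc 0 T, ∫⁻ z : SpaceTime d,
          f (u, z.2) * ENNReal.ofReal (fracKernel H u z.1) *
            (g (v, z.2) * ENNReal.ofReal (fracKernel H v z.1)) := by
        refine lintegral_congr fun u => lintegral_lintegral_swap ?_
        exact (hm.comp (by fun_prop : Measurable fun q : SpaceTime d × ℝ =>
          (((q.1, u), q.2) : (SpaceTime d × ℝ) × ℝ))).aemeasurable
    _ = ∫⁻ u in Icc 0 T, ∫⁻ v in Icc 0 T, fracConst H *
          ∫⁻ x : EuclideanSpace ℝ (Fin d),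
            f (u, x) * g (v, x) * ENNReal.ofReal (|u - v| ^ (2 * H - 2)) := by
        refine lintegral_congr fun u => lintegral_congr_ae ?_
        filter_upwards [ae_fst_ne u] with v huv
        have h1 := hkm u
        have h2 := hkm v
        rw [lintegral_mul_const _ (by fun_prop), mul_comm (∫⁻ x, _), ← mul_assoc,
          ← lintegral_fracKernel_mul huv, Measure.volume_eq_prod,
          ← lintegral_prod_mul (by fun_prop) (by fun_prop)]
        refine lintegral_congr fun z => by ring
    _ = fracConst H * energy H T f g := by
        have hm2 : Measurable fun q : (ℝ × ℝ) × EuclideanSpace ℝ (Fin d) =>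
          f (q.1.1, q.2) * g (q.1.2, q.2) *
            ENNReal.ofReal (|q.1.1 - q.1.2| ^ (2 * H - 2)) := by fun_prop
        have hm3 := hm2.lintegral_prod_right' (ν := volume)
        refine Eq.trans (lintegral_congr fun u => ?_) (lintegral_const_mul _
          (hm3.lintegral_prod_right' (ν := volume.restrict (Icc 0 T))))
        exact lintegral_const_mul _ (hm3.comp measurable_prodMk_left)

lemma energy_mono {H T : ℝ} {f f' g g' : SpaceTime d → ℝ≥0∞} (hf : ∀ p, f p ≤ f' p)
    (hg : ∀ p, g p ≤ g' p) : energy H T f g ≤ energy H T f' g' := by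
  unfold energy
  gcongr <;> simp [hf, hg]

/-- Finiteness of the mixed energy, a weak form of the Cauchy–Schwarz inequality. -/
lemma energy_le_add {H T : ℝ} (hH : 1 / 2 < H) (hH' : H < 1) {f g : SpaceTime d → ℝ≥0∞}
    (hf : Measurable f) (hg : Measurable g) :
    energy H T f g ≤ energy H T f f + energy H T g g := by
  have h0 := fracConst_ne_zero H
  have h1 := fracConst_ne_top hH hH'
  rw [← ENNReal.mul_le_mul_iff_right h0 h1, mul_add, ← lintegral_lfrac_mul H T hf hg,
    ← lintegral_lfrac_mul H T hf hf, ← lintegral_lfrac_mul H T hg hg,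
    ← lintegral_add_left (f := fun z => lfrac H T f z * lfrac H T f z)
      ((measurable_lfrac H T hf).mul (measurable_lfrac H T hf))]
  refine lintegral_mono fun z => ?_
  rcases le_total (lfrac H T f z) (lfrac H T g z) with h | h
  · exact (mul_le_mul_left h _).trans le_add_self
  · exact (mul_le_mul_right h _).trans le_self_add

lemma enorm_fracKernel (H u w : ℝ) : ‖fracKernel H u w‖ₑ = ENNReal.ofReal (fracKernel H u w) := by
  rw [← ofReal_norm, Real.norm_of_nonneg (fracKernel_nonneg H u w)]

section

variable {H T : ℝ} {φ ψ : SpaceTime d → ℝ}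

lemma measurable_frac_integrand (hφ : Measurable φ) :
    Measurable fun q : SpaceTime d × ℝ => φ (q.2, q.1.2) * fracKernel H q.2 q.1.1 :=
  (by fun_prop : Measurable fun q : SpaceTime d × ℝ => φ (q.2, q.1.2)).mul
    ((measurable_fracKernel H).comp (by fun_prop : Measurable fun q : SpaceTime d × ℝ =>
      ((q.2, q.1.1) : ℝ × ℝ)))

lemma stronglyMeasurable_frac (hφ : Measurable φ) : StronglyMeasurable (frac H T φ) :=
  (measurable_frac_integrand (H := H) hφ).stronglyMeasurable.integral_prod_right'

lemma enorm_frac_le (z : SpaceTime d) : ‖frac H T φ z‖ₑ ≤ lfrac H T (fun p => ‖φ p‖ₑ) z := by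
  refine (enorm_integral_le_lintegral_enorm _).trans (le_of_eq ?_)
  simp_rw [enorm_mul, enorm_fracKernel, lfrac]

lemma MemAbsH.lintegral_lfrac_sq_lt_top (hH : 1 / 2 < H) (hH' : H < 1) (hφ : MemAbsH H T φ) :
    ∫⁻ z, lfrac H T (fun p => ‖φ p‖ₑ) z * lfrac H T (fun p => ‖φ p‖ₑ) z < ∞ := by
  rw [lintegral_lfrac_mul H T hφ.1.enorm hφ.1.enorm]
  exact ENNReal.mul_lt_top (fracConst_ne_top hH hH').lt_top (memAbsH_iff.1 hφ).2

lemma MemAbsH.ae_lfrac_lt_top (hH : 1 / 2 < H) (hH' : H < 1) (hφ : MemAbsH H T φ) :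
    ∀ᵐ z, lfrac H T (fun p => ‖φ p‖ₑ) z < ∞ := by
  have hm := measurable_lfrac H T hφ.1.enorm
  filter_upwards [ae_lt_top (hm.mul hm) (hφ.lintegral_lfrac_sq_lt_top hH hH').ne] with z hz
  by_contra h
  simp only [not_lt, top_le_iff] at h
  simp [h] at hz

lemma MemAbsH.ae_integrable (hH : 1 / 2 < H) (hH' : H < 1) (hφ : MemAbsH H T φ) :
    ∀ᵐ z : SpaceTime d, IntegrableOn (fun u => φ (u, z.2) * fracKernel H u z.1) (Icc 0 T) := by
  filter_upwards [hφ.ae_lfrac_lt_top hH hH'] with z hz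
  refine ⟨((measurable_frac_integrand hφ.1).comp measurable_prodMk_left).aestronglyMeasurable, ?_⟩
  simpa [HasFiniteIntegral, enorm_mul, enorm_fracKernel, lfrac] using hz

lemma memLp_two_of_lintegral {α : Type*} [MeasurableSpace α] {μ : Measure α} {f : α → ℝ}
    (hf : AEStronglyMeasurable f μ) (h : ∫⁻ z, ‖f z‖ₑ ^ 2 ∂μ < ∞) : MemLp f 2 μ := by
  refine ⟨hf, (eLpNorm_lt_top_iff_lintegral_rpow_enorm_lt_top (by simp) (by simp)).2 ?_⟩
  simpa using h

lemma MemAbsH.memLp_frac (hH : 1 / 2 < H) (hH' : H < 1) (hφ : MemAbsH H T φ) :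
    MemLp (frac H T φ) 2 := by
  refine memLp_two_of_lintegral (stronglyMeasurable_frac hφ.1).aestronglyMeasurable
    (lt_of_le_of_lt (lintegral_mono fun z => ?_) (hφ.lintegral_lfrac_sq_lt_top hH hH'))
  rw [pow_two]
  exact mul_le_mul' (enorm_frac_le z) (enorm_frac_le z)

lemma MemAbsH.energy_lt_top (hH : 1 / 2 < H) (hH' : H < 1) (hφ : MemAbsH H T φ)
    (hψ : MemAbsH H T ψ) : energy H T (fun p => ‖φ p‖ₑ) (fun p => ‖ψ p‖ₑ) < ∞ :=
  (energy_le_add hH hH' hφ.1.enorm hψ.1.enorm).trans_lt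
    (ENNReal.add_lt_top.2 ⟨(memAbsH_iff.1 hφ).2, (memAbsH_iff.1 hψ).2⟩)

lemma lfrac_add {f f' : SpaceTime d → ℝ≥0∞} (hf : Measurable f) (z : SpaceTime d) :
    lfrac H T (fun p => f p + f' p) z = lfrac H T f z + lfrac H T f' z := by
  simp only [lfrac, add_mul]
  exact lintegral_add_left ((by fun_prop : Measurable fun u => f (u, z.2)).mul
      ((measurable_fracKernel H).comp (measurable_id.prodMk measurable_const)).ennreal_ofReal) _

lemma energy_add_left {f f' g : SpaceTime d → ℝ≥0∞} (hf : Measurable f) (hf' : Measurable f')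
    (hg : Measurable g) (hH : 1 / 2 < H) (hH' : H < 1) :
    energy H T (fun p => f p + f' p) g = energy H T f g + energy H T f' g := by
  have h0 := fracConst_ne_zero H
  have h1 := fracConst_ne_top hH hH'
  rw [← ENNReal.mul_right_inj h0 h1, mul_add, ← lintegral_lfrac_mul H T (f := fun p => f p + f' p) (hf.add hf') hg,
    ← lintegral_lfrac_mul H T hf hg, ← lintegral_lfrac_mul H T hf' hg,
    ← lintegral_add_left (f := fun z => lfrac H T f z * lfrac H T g z)
      ((measurable_lfrac H T hf).mul (measurable_lfrac H T hg))]
  refine lintegral_congr fun z => ?_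
  rw [← add_mul, lfrac_add hf]

lemma energy_comm (H T : ℝ) {f g : SpaceTime d → ℝ≥0∞} (hf : Measurable f)
    (hg : Measurable g) (hH : 1 / 2 < H) (hH' : H < 1) :
    energy H T f g = energy H T g f := by
  rw [← ENNReal.mul_right_inj (fracConst_ne_zero H) (fracConst_ne_top hH hH'),
    ← lintegral_lfrac_mul H T hf hg, ← lintegral_lfrac_mul H T hg hf]
  simp_rw [mul_comm]

lemma MemAbsH.sub (hH : 1 / 2 < H) (hH' : H < 1) (hφ : MemAbsH H T φ)
    (hψ : MemAbsH H T ψ) : MemAbsH H T (fun p => φ p - ψ p) := by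
  refine memAbsH_iff.2 ⟨hφ.1.sub hψ.1, ?_⟩
  have mφ := hφ.1.enorm
  have mψ := hψ.1.enorm
  refine lt_of_le_of_lt (energy_mono (f' := fun p => ‖φ p‖ₑ + ‖ψ p‖ₑ)
    (g' := fun p => ‖φ p‖ₑ + ‖ψ p‖ₑ) (fun p => enorm_sub_le) (fun p => enorm_sub_le)) ?_
  rw [energy_add_left mφ mψ (by fun_prop) hH hH', energy_comm H T mφ (by fun_prop) hH hH',
    energy_comm H T mψ (by fun_prop) hH hH', energy_add_left mφ mψ mφ hH hH',
    energy_add_left mφ mψ mψ hH hH']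
  simp only [ENNReal.add_lt_top]
  exact ⟨⟨hφ.energy_lt_top hH hH' hφ, hψ.energy_lt_top hH hH' hφ⟩,
    hφ.energy_lt_top hH hH' hψ, hψ.energy_lt_top hH hH' hψ⟩

end

section

variable {H T : ℝ} {φ ψ : SpaceTime d → ℝ}

lemma integral_fracKernel_mul {u v : ℝ} (huv : u ≠ v) :
    ∫ w, fracKernel H u w * fracKernel H v w =
      (fracConst H).toReal * |u - v| ^ (2 * H - 2) := by
  have hm : ∀ u : ℝ, Measurable fun w => fracKernel H u w := fun u =>
    (measurable_fracKernel H).comp (measurable_const.prodMk measurable_id)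
  rw [integral_eq_lintegral_of_nonneg_ae
    (ae_of_all _ fun w => mul_nonneg (fracKernel_nonneg H u w) (fracKernel_nonneg H v w))
    ((hm u).mul (hm v)).aestronglyMeasurable]
  simp_rw [ENNReal.ofReal_mul (fracKernel_nonneg H u _)]
  rw [lintegral_fracKernel_mul huv, ENNReal.toReal_mul, ENNReal.toReal_ofReal]
  exact Real.rpow_nonneg (abs_nonneg _) _

/-- The integrand of the pairing of two fractional integrals is integrable in the outer variable
`z = (w,x)` and the pair of times `(u,v)` jointly, which licenses every later use of Fubini's
theorem for the pairing. -/
lemma integrable_pairing (hH : 1 / 2 < H) (hH' : H < 1) (hφ : MemAbsH H T φ)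
    (hψ : MemAbsH H T ψ) :
    Integrable (fun q : SpaceTime d × (ℝ × ℝ) =>
      (φ (q.2.1, q.1.2) * fracKernel H q.2.1 q.1.1) *
        (ψ (q.2.2, q.1.2) * fracKernel H q.2.2 q.1.1))
      (volume.prod ((volume.restrict (Icc 0 T)).prod (volume.restrict (Icc 0 T)))) := by
  have m1 : Measurable fun q : SpaceTime d × (ℝ × ℝ) =>
      φ (q.2.1, q.1.2) * fracKernel H q.2.1 q.1.1 :=
    (measurable_frac_integrand (H := H) hφ.1).comp
      (by fun_prop : Measurable fun q : SpaceTime d × (ℝ × ℝ) => (q.1, q.2.1))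
  have m2 : Measurable fun q : SpaceTime d × (ℝ × ℝ) =>
      ψ (q.2.2, q.1.2) * fracKernel H q.2.2 q.1.1 :=
    (measurable_frac_integrand (H := H) hψ.1).comp
      (by fun_prop : Measurable fun q : SpaceTime d × (ℝ × ℝ) => (q.1, q.2.2))
  refine ⟨(m1.mul m2).aestronglyMeasurable, ?_⟩
  refine lt_of_eq_of_lt (lintegral_prod _ (m1.mul m2).enorm.aemeasurable) ?_
  simp only
  have : ∀ z : SpaceTime d, ∫⁻ q : ℝ × ℝ, ‖(φ (q.1, z.2) * fracKernel H q.1 z.1) *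
      (ψ (q.2, z.2) * fracKernel H q.2 z.1)‖ₑ
        ∂((volume.restrict (Icc 0 T)).prod (volume.restrict (Icc 0 T))) =
      lfrac H T (fun p => ‖φ p‖ₑ) z * lfrac H T (fun p => ‖ψ p‖ₑ) z := by
    intro z
    have n1 : Measurable fun u => φ (u, z.2) * fracKernel H u z.1 :=
      (measurable_frac_integrand (H := H) hφ.1).comp measurable_prodMk_left
    have n2 : Measurable fun u => ψ (u, z.2) * fracKernel H u z.1 :=
      (measurable_frac_integrand (H := H) hψ.1).comp measurable_prodMk_left
    simp_rw [enorm_mul (φ _ * _)]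
    rw [lintegral_prod_mul n1.enorm.aemeasurable n2.enorm.aemeasurable]
    simp_rw [enorm_mul, enorm_fracKernel]
    rfl
  simp_rw [this]
  rw [lintegral_lfrac_mul H T hφ.1.enorm hψ.1.enorm]
  exact ENNReal.mul_lt_top (fracConst_ne_top hH hH').lt_top (hφ.energy_lt_top hH hH' hψ)

/-- The inner product of `𝓗` is the `L²` inner product of the fractional integrals. -/
lemma integral_frac_mul (hH : 1 / 2 < H) (hH' : H < 1) (hφ : MemAbsH H T φ)
    (hψ : MemAbsH H T ψ) :
    H * (2 * H - 1) * ∫ z, frac H T φ z * frac H T ψ z =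
      (fracConst H).toReal * innerH H T φ ψ := by
  have hint := integrable_pairing hH hH' hφ hψ
  have hsec : ∀ u v : ℝ, u ≠ v → ∫ z : SpaceTime d, (φ (u, z.2) * fracKernel H u z.1) *
      (ψ (v, z.2) * fracKernel H v z.1) =
      (fracConst H).toReal * ∫ x, φ (u, x) * |u - v| ^ (2 * H - 2) * ψ (v, x) := by
    intro u v huv
    have : ∀ z : SpaceTime d, (φ (u, z.2) * fracKernel H u z.1) *
        (ψ (v, z.2) * fracKernel H v z.1) =
        (fracKernel H u z.1 * fracKernel H v z.1) * (φ (u, z.2) * ψ (v, z.2)) :=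
      fun z => by ring
    simp_rw [this]
    rw [Measure.volume_eq_prod, integral_prod_mul (fun w => fracKernel H u w * fracKernel H v w)
      (fun x => φ (u, x) * ψ (v, x)), integral_fracKernel_mul huv, mul_assoc,
      ← integral_const_mul]
    congr 1
    refine integral_congr_ae (ae_of_all _ fun x => by ring)
  have h1 : ∫ z, frac H T φ z * frac H T ψ z =
      ∫ u in Icc 0 T, ∫ v in Icc 0 T, ∫ z : SpaceTime d, (φ (u, z.2) * fracKernel H u z.1) *
        (ψ (v, z.2) * fracKernel H v z.1) := by
    calc ∫ z, frac H T φ z * frac H T ψ z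
        = ∫ z : SpaceTime d, ∫ q : ℝ × ℝ, (φ (q.1, z.2) * fracKernel H q.1 z.1) *
          (ψ (q.2, z.2) * fracKernel H q.2 z.1)
            ∂((volume.restrict (Icc 0 T)).prod (volume.restrict (Icc 0 T))) := by
          refine integral_congr_ae (ae_of_all _ fun z => ?_)
          exact (integral_prod_mul (fun u => φ (u, z.2) * fracKernel H u z.1)
            (fun u => ψ (u, z.2) * fracKernel H u z.1)).symm
      _ = _ := by
          rw [integral_integral_swap hint, integral_prod]
          exact hint.integral_prod_right
  rw [h1, innerH, mul_left_comm]
  congr 1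
  rw [← integral_const_mul]
  refine integral_congr_ae (ae_of_all _ fun u => ?_)
  simp only
  rw [← integral_const_mul]
  refine integral_congr_ae ?_
  filter_upwards [ae_fst_ne u] with v huv using hsec u v huv

/-- The fractional integral of a function of `|𝓗|` as an element of `L²`, and `0` for functions
whose fractional integral is not square-integrable. -/
noncomputable def fracL2 (H T : ℝ) (φ : SpaceTime d → ℝ) : Lp ℝ 2 (volume : Measure (SpaceTime d)) :=
  open Classical in if h : MemLp (frac H T φ) 2 volume then h.toLp _ else 0

lemma MemAbsH.coeFn_fracL2 (hH : 1 / 2 < H) (hH' : H < 1) (hφ : MemAbsH H T φ) :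
    fracL2 H T φ =ᵐ[volume] frac H T φ := by
  rw [fracL2, dif_pos (hφ.memLp_frac hH hH')]
  exact MemLp.coeFn_toLp _

/-- `φ ↦ fracL2 H T φ` is, up to a positive constant, an isometry from `|𝓗|` into `L²`. In
particular the form `innerH` is positive semidefinite on `|𝓗|`. -/
lemma innerH_eq_inner (hH : 1 / 2 < H) (hH' : H < 1) (hφ : MemAbsH H T φ)
    (hψ : MemAbsH H T ψ) :
    innerH H T φ ψ = H * (2 * H - 1) / (fracConst H).toReal *
      inner ℝ (fracL2 H T φ) (fracL2 H T ψ) := by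
  have hc : (fracConst H).toReal ≠ 0 :=
    (ENNReal.toReal_pos (fracConst_ne_zero H) (fracConst_ne_top hH hH')).ne'
  rw [div_mul_eq_mul_div, eq_div_iff hc, mul_comm, ← integral_frac_mul hH hH' hφ hψ, L2.inner_def]
  congr 1
  refine integral_congr_ae ?_
  filter_upwards [hφ.coeFn_fracL2 hH hH', hψ.coeFn_fracL2 hH hH'] with z h1 h2
  rw [h1, h2]
  simp [mul_comm]

lemma frac_linear (hH : 1 / 2 < H) (hH' : H < 1) (hφ : MemAbsH H T φ)
    (hψ : MemAbsH H T ψ) (a b : ℝ) :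
    frac H T (fun p => a * φ p + b * ψ p) =ᵐ[volume]
      fun z => a * frac H T φ z + b * frac H T ψ z := by
  filter_upwards [hφ.ae_integrable hH hH', hψ.ae_integrable hH hH'] with z h1 h2
  simp only [frac]
  rw [← integral_const_mul, ← integral_const_mul, ← integral_add (h1.const_mul a) (h2.const_mul b)]
  refine integral_congr_ae (ae_of_all _ fun u => by ring)

lemma MemAbsH.const_mul (hφ : MemAbsH H T φ) (a : ℝ) : MemAbsH H T (fun p => a * φ p) := by
  refine memAbsH_iff.2 ⟨hφ.1.const_mul a, ?_⟩
  have : energy H T (fun p => ‖a * φ p‖ₑ) (fun p => ‖a * φ p‖ₑ) =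
      (‖a‖ₑ * ‖a‖ₑ) * energy H T (fun p => ‖φ p‖ₑ) (fun p => ‖φ p‖ₑ) := by
    simp only [energy]
    rw [← lintegral_const_mul' _ _ (by simp [ENNReal.mul_eq_top])]
    refine lintegral_congr fun u => ?_
    rw [← lintegral_const_mul' _ _ (by simp [ENNReal.mul_eq_top])]
    refine lintegral_congr fun v => ?_
    rw [← lintegral_const_mul' _ _ (by simp [ENNReal.mul_eq_top])]
    refine lintegral_congr fun x => ?_
    simp only [enorm_mul]
    ring
  rw [this]
  exact ENNReal.mul_lt_top (by simp [ENNReal.mul_lt_top_iff]) (memAbsH_iff.1 hφ).2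

lemma MemAbsH.linear (hH : 1 / 2 < H) (hH' : H < 1) (hφ : MemAbsH H T φ)
    (hψ : MemAbsH H T ψ) (a b : ℝ) : MemAbsH H T (fun p => a * φ p + b * ψ p) := by
  have := (hφ.const_mul a).sub hH hH' (hψ.const_mul (-b))
  simpa [sub_eq_add_neg] using this

lemma fracL2_linear (hH : 1 / 2 < H) (hH' : H < 1) (hφ : MemAbsH H T φ)
    (hψ : MemAbsH H T ψ) (a b : ℝ) :
    fracL2 H T (fun p => a * φ p + b * ψ p) = a • fracL2 H T φ + b • fracL2 H T ψ := by
  ext1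
  filter_upwards [(hφ.linear hH hH' hψ a b).coeFn_fracL2 hH hH', hφ.coeFn_fracL2 hH hH',
    hψ.coeFn_fracL2 hH hH', frac_linear hH hH' hφ hψ a b,
    Lp.coeFn_add (a • fracL2 H T φ) (b • fracL2 H T ψ), Lp.coeFn_smul a (fracL2 H T φ),
    Lp.coeFn_smul b (fracL2 H T ψ)] with z h1 h2 h3 h4 h5 h6 h7
  rw [h1, h4, h5, Pi.add_apply, h6, h7, Pi.smul_apply, Pi.smul_apply, h2, h3, smul_eq_mul,
    smul_eq_mul]

lemma fracL2_sub (hH : 1 / 2 < H) (hH' : H < 1) (hφ : MemAbsH H T φ)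
    (hψ : MemAbsH H T ψ) :
    fracL2 H T (fun p => φ p - ψ p) = fracL2 H T φ - fracL2 H T ψ := by
  have := fracL2_linear hH hH' hφ hψ 1 (-1)
  simpa [sub_eq_add_neg] using this

end

/-! ### Bounded functions and test functions in `|𝓗|` -/

section

variable {H T : ℝ} {φ ψ : SpaceTime d → ℝ}

lemma lintegral_Ioc_rpow_lt_top {r : ℝ} (hr : -1 < r) (T : ℝ) :
    ∫⁻ s in Ioc 0 T, ENNReal.ofReal (s ^ r) < ∞ := by
  rcases le_total T 0 with hT | hT
  · simp [Ioc_eq_empty_of_le hT]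
  · exact ((intervalIntegrable_iff_integrableOn_Ioc_of_le hT).1
      (intervalIntegral.intervalIntegrable_rpow' hr)).lintegral_lt_top

lemma lintegral_abs_sub_rpow_le {T u : ℝ} (hu : u ∈ Icc 0 T) (r : ℝ) :
    ∫⁻ v in Icc 0 T, ENNReal.ofReal (|u - v| ^ r) ≤
      2 * ∫⁻ s in Ioc 0 T, ENNReal.ofReal (s ^ r) := by
  set h : ℝ → ℝ≥0∞ := (Ioc 0 T).indicator fun s => ENNReal.ofReal (s ^ r) with hh
  have hm : Measurable h := Measurable.indicator (by fun_prop) measurableSet_Ioc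
  calc ∫⁻ v in Icc 0 T, ENNReal.ofReal (|u - v| ^ r)
      ≤ ∫⁻ v in Icc 0 T, (h (u - v) + h (v - u)) := by
        refine lintegral_mono_ae ?_
        filter_upwards [ae_restrict_mem measurableSet_Icc, ae_fst_ne u] with v hv huv
        rcases lt_or_gt_of_ne huv with h1 | h1
        · have : v - u ∈ Ioc 0 T := ⟨by linarith, by linarith [hv.2, hu.1]⟩
          rw [abs_sub_comm, abs_of_pos this.1]
          exact le_add_left (by rw [hh, indicator_of_mem this])
        · have : u - v ∈ Ioc 0 T := ⟨by linarith, by linarith [hv.1, hu.2]⟩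
          rw [abs_of_pos this.1]
          exact le_add_right (by rw [hh, indicator_of_mem this])
    _ ≤ ∫⁻ v, (h (u - v) + h (v - u)) := setLIntegral_le_lintegral _ _
    _ = 2 * ∫⁻ s in Ioc 0 T, ENNReal.ofReal (s ^ r) := by
        rw [lintegral_add_left (by fun_prop), lintegral_sub_left_eq_self,
          lintegral_sub_right_eq_self, ← two_mul, hh, lintegral_indicator measurableSet_Ioc]

lemma energy_le_of_bound {f : SpaceTime d → ℝ≥0∞} (hf : Measurable f) {C M : ℝ≥0∞}
    (hC : ∀ u ∈ Icc 0 T, ∀ x, f (u, x) ≤ C) (hM : ∀ u ∈ Icc 0 T, ∫⁻ x, f (u, x) ≤ M) :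
    energy H T f f ≤
      C * M * (2 * ∫⁻ s in Ioc 0 T, ENNReal.ofReal (s ^ (2 * H - 2))) * ENNReal.ofReal T := by
  calc energy H T f f
      ≤ ∫⁻ u in Icc 0 T, C * M * (2 * ∫⁻ s in Ioc 0 T, ENNReal.ofReal (s ^ (2 * H - 2))) := by
        refine setLIntegral_mono' measurableSet_Icc fun u hu => ?_
        refine le_trans ?_ (mul_le_mul_right (lintegral_abs_sub_rpow_le hu _) _)
        rw [← lintegral_const_mul _ (by fun_prop)]
        refine setLIntegral_mono' measurableSet_Icc fun v hv => ?_
        rw [lintegral_mul_const _ (by fun_prop)]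
        gcongr
        refine le_trans (lintegral_mono (g := fun x => C * f (v, x)) fun x => ?_) ?_
        · exact mul_le_mul_left (hC u hu x) _
        · rw [lintegral_const_mul _ (by fun_prop)]
          exact mul_le_mul_right (hM v hv) _
    _ = _ := by simp

/-- Functions that are bounded on the strip and integrable in space, uniformly in time, belong to
`|𝓗|`, because `|u - v| ^ (2H - 2)` is integrable in `v`, uniformly in `u`. -/
lemma memAbsH_of_bound (hH : 1 / 2 < H) (hφ : Measurable φ) {C M : ℝ≥0∞} (hCt : C ≠ ∞)
    (hMt : M ≠ ∞) (hC : ∀ u ∈ Icc 0 T, ∀ x, ‖φ (u, x)‖ₑ ≤ C)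
    (hM : ∀ u ∈ Icc 0 T, ∫⁻ x, ‖φ (u, x)‖ₑ ≤ M) : MemAbsH H T φ := by
  refine memAbsH_iff.2 ⟨hφ, (energy_le_of_bound hφ.enorm hC hM).trans_lt ?_⟩
  have := (lintegral_Ioc_rpow_lt_top (r := 2 * H - 2) (by linarith) T).ne
  exact (ENNReal.mul_ne_top (ENNReal.mul_ne_top (ENNReal.mul_ne_top hCt hMt)
    (ENNReal.mul_ne_top (by simp) this)) (by simp)).lt_top

lemma lintegral_section_le {C : ℝ≥0∞} {K : Set (SpaceTime d)} (hK : IsCompact K)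
    (hC : ∀ p, ‖φ p‖ₑ ≤ C) (h0 : ∀ p, p ∉ K → φ p = 0) (u : ℝ) :
    ∫⁻ x, ‖φ (u, x)‖ₑ ≤ C * volume (Prod.snd '' K) := by
  rw [← lintegral_indicator_const (hK.image continuous_snd).measurableSet]
  refine lintegral_mono fun x => ?_
  by_cases hx : x ∈ Prod.snd '' K
  · rw [indicator_of_mem hx]
    exact hC _
  · rw [h0 (u, x) fun h => hx ⟨_, h, rfl⟩]
    simp

lemma memAbsH_of_compact (hH : 1 / 2 < H) (hφ : Measurable φ) {C : ℝ≥0∞} (hCt : C ≠ ∞)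
    {K : Set (SpaceTime d)} (hK : IsCompact K) (hC : ∀ p, ‖φ p‖ₑ ≤ C)
    (h0 : ∀ p, p ∉ K → φ p = 0) : MemAbsH H T φ :=
  memAbsH_of_bound hH hφ hCt
    (ENNReal.mul_ne_top hCt (hK.image continuous_snd).measure_lt_top.ne)
    (fun u _ x => hC (u, x)) fun u _ => lintegral_section_le hK hC h0 u

lemma exists_bound_testFn (η : TestFn d T) : ∃ C : ℝ, 0 ≤ C ∧ ∀ p, ‖η p‖ ≤ C := by
  obtain ⟨C, hC⟩ := η.continuous.bounded_above_of_compact_support η.hasCompactSupport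
  exact ⟨C, (norm_nonneg _).trans (hC 0), hC⟩

lemma memAbsH_testFn (hH : 1 / 2 < H) (η : TestFn d T) : MemAbsH H T η := by
  obtain ⟨C, hC0, hC⟩ := exists_bound_testFn η
  refine memAbsH_of_compact hH η.continuous.measurable (C := ENNReal.ofReal C) (by simp)
    η.hasCompactSupport.isCompact (fun p => ?_) fun p hp => image_eq_zero_of_notMem_tsupport hp
  rw [← ofReal_norm]
  exact ENNReal.ofReal_le_ofReal (hC p)

/-! ### Density of the test functions -/

lemma volume_restrict_closedStrip (d : ℕ) (T : ℝ) :
    (volume : Measure (SpaceTime d)).restrict (closedStrip d T) =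
      (volume.restrict (Icc 0 T)).prod volume := by
  rw [closedStrip, Measure.volume_eq_prod, ← Measure.prod_restrict, Measure.restrict_univ]

lemma volume_restrict_openStrip (d : ℕ) (T : ℝ) :
    (volume : Measure (SpaceTime d)).restrict (openStrip d T) =
      volume.restrict (closedStrip d T) := by
  rw [volume_restrict_closedStrip, ← Measure.restrict_congr_set Ioo_ae_eq_Icc]
  change (volume : Measure (SpaceTime d)).restrict (Ioo 0 T ×ˢ univ) = _
  rw [Measure.volume_eq_prod, ← Measure.prod_restrict, Measure.restrict_univ]

lemma isOpen_openStrip (d : ℕ) (T : ℝ) : IsOpen (openStrip d T : Set (SpaceTime d)) :=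
  (openStrip d T).isOpen

/-- The adjoint of the fractional integral, with its default value `0` where the integral does not
converge. -/
noncomputable def fracAdj (H : ℝ) (h : SpaceTime d → ℝ) (p : SpaceTime d) : ℝ :=
  ∫ w, h (w, p.2) * fracKernel H p.1 w

lemma measurable_adj_integrand {h : SpaceTime d → ℝ} (hh : Measurable h) (hφ : Measurable φ) :
    Measurable fun q : SpaceTime d × ℝ =>
      φ q.1 * (h (q.2, q.1.2) * fracKernel H q.1.1 q.2) := by
  have h1 : Measurable fun q : SpaceTime d × ℝ => fracKernel H q.1.1 q.2 :=
    (measurable_fracKernel H).comp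
      (by fun_prop : Measurable fun q : SpaceTime d × ℝ => ((q.1.1, q.2) : ℝ × ℝ))
  fun_prop

lemma lintegral_adj_le (hφ : Measurable φ) {h : SpaceTime d → ℝ} (hh : Measurable h) :
    ∫⁻ q : SpaceTime d × ℝ, ‖φ q.1 * (h (q.2, q.1.2) * fracKernel H q.1.1 q.2)‖ₑ
      ∂(((volume.restrict (Icc 0 T)).prod volume).prod volume) ≤
      (∫⁻ z, ‖h z‖ₑ ^ 2) + fracConst H * energy H T (fun p => ‖φ p‖ₑ) (fun p => ‖φ p‖ₑ) := by
  have hm := measurable_adj_integrand (H := H) hh hφ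
  refine le_of_eq_of_le (lintegral_prod_symm' _ hm.enorm) ?_
  have e1 : ∀ w : ℝ, ∫⁻ p : SpaceTime d, ‖φ p * (h (w, p.2) * fracKernel H p.1 w)‖ₑ
        ∂((volume.restrict (Icc 0 T)).prod volume) =
      ∫⁻ x, ‖h (w, x)‖ₑ * lfrac H T (fun p => ‖φ p‖ₑ) (w, x) := by
    intro w
    refine (lintegral_prod_symm' _ (hm.enorm.comp measurable_prodMk_right)).trans ?_
    refine lintegral_congr fun x => ?_
    simp only [Function.comp_apply, lfrac]
    rw [← lintegral_const_mul' _ _ (by simp)]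
    refine lintegral_congr fun u => ?_
    simp only [enorm_mul, enorm_fracKernel]
    ring
  have ml := measurable_lfrac H T hφ.enorm
  simp_rw [e1]
  rw [← lintegral_prod (fun z : SpaceTime d => ‖h z‖ₑ * lfrac H T (fun p => ‖φ p‖ₑ) z)
    (hh.enorm.mul ml).aemeasurable, ← lintegral_lfrac_mul H T hφ.enorm hφ.enorm,
    ← lintegral_add_left (hh.enorm.pow_const 2), ← Measure.volume_eq_prod]
  refine lintegral_mono fun z => ?_
  simp only [pow_two]
  rcases le_total ‖h z‖ₑ (lfrac H T (fun p => ‖φ p‖ₑ) z) with h | h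
  · exact (mul_le_mul_left h _).trans le_add_self
  · exact (mul_le_mul_right h _).trans le_self_add

lemma lintegral_sq_lt_top {α : Type*} [MeasurableSpace α] {μ : Measure α} {f : α → ℝ}
    (h : MemLp f 2 μ) : ∫⁻ z, ‖f z‖ₑ ^ 2 ∂μ < ∞ := by
  simpa using (eLpNorm_lt_top_iff_lintegral_rpow_enorm_lt_top (by simp) (by simp)).1 h.2

lemma integrable_adj (hH : 1 / 2 < H) (hH' : H < 1) (hφ : MemAbsH H T φ)
    {h : SpaceTime d → ℝ} (hh : Measurable h) (h2 : MemLp h 2) :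
    Integrable (fun q : SpaceTime d × ℝ => φ q.1 * (h (q.2, q.1.2) * fracKernel H q.1.1 q.2))
      (((volume.restrict (Icc 0 T)).prod volume).prod volume) :=
  ⟨(measurable_adj_integrand hh hφ.1).aestronglyMeasurable, (lintegral_adj_le hφ.1 hh).trans_lt
    (ENNReal.add_lt_top.2 ⟨lintegral_sq_lt_top h2,
      ENNReal.mul_lt_top (fracConst_ne_top hH hH').lt_top (memAbsH_iff.1 hφ).2⟩)⟩

lemma stronglyMeasurable_fracAdj {h : SpaceTime d → ℝ} (hh : Measurable h) :
    StronglyMeasurable (fracAdj H h) := by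
  have := measurable_adj_integrand (H := H) hh (measurable_const (a := (1 : ℝ)))
  simp only [one_mul] at this
  exact this.stronglyMeasurable.integral_prod_right'

lemma lintegral_mul_fracAdj_le (hφ : Measurable φ) {h : SpaceTime d → ℝ} (hh : Measurable h) :
    ∫⁻ p in closedStrip d T, ‖φ p * fracAdj H h p‖ₑ ≤
      (∫⁻ z, ‖h z‖ₑ ^ 2) + fracConst H * energy H T (fun p => ‖φ p‖ₑ) (fun p => ‖φ p‖ₑ) := by
  refine le_trans ?_ (lintegral_adj_le hφ hh)
  rw [volume_restrict_closedStrip,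
    lintegral_prod _ (measurable_adj_integrand hh hφ).enorm.aemeasurable]
  refine lintegral_mono fun p => ?_
  rw [fracAdj, ← integral_const_mul]
  exact enorm_integral_le_lintegral_enorm _

/-- Duality between the fractional integral and its adjoint. It turns the `𝓗`-pairing with a fixed
element into integration against a function on the strip. -/
lemma integral_mul_fracAdj (hH : 1 / 2 < H) (hH' : H < 1) (hφ : MemAbsH H T φ)
    {h : SpaceTime d → ℝ} (hh : Measurable h) (h2 : MemLp h 2) :
    ∫ p in closedStrip d T, φ p * fracAdj H h p = ∫ z, h z * frac H T φ z := by
  have hint := integrable_adj hH hH' hφ hh h2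
  have e1 : ∀ p : SpaceTime d, φ p * fracAdj H h p =
      ∫ w, φ p * (h (w, p.2) * fracKernel H p.1 w) := fun p => by
    rw [fracAdj, integral_const_mul]
  simp_rw [e1, volume_restrict_closedStrip]
  rw [← integral_prod _ hint, integral_prod_symm _ hint, Measure.volume_eq_prod,
    integral_prod _ (by
      rw [← Measure.volume_eq_prod]; exact h2.integrable_mul (hφ.memLp_frac hH hH'))]
  refine integral_congr_ae ?_
  filter_upwards [hint.prod_left_ae] with w hw
  refine (integral_prod_symm _ hw).trans (integral_congr_ae (ae_of_all _ fun x => ?_))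
  simp only [frac]
  rw [← integral_const_mul]
  refine integral_congr_ae (ae_of_all _ fun u => by ring)

lemma integrable_mul_fracAdj (hH : 1 / 2 < H) (hH' : H < 1) (hφ : MemAbsH H T φ)
    {h : SpaceTime d → ℝ} (hh : Measurable h) (h2 : MemLp h 2) :
    IntegrableOn (fun p => φ p * fracAdj H h p) (closedStrip d T) := by
  have := (integrable_adj hH hH' hφ hh h2).integral_prod_left
  rw [IntegrableOn, volume_restrict_closedStrip]
  refine this.congr (ae_of_all _ fun p => ?_)
  simp only [fracAdj]
  rw [integral_const_mul]

/-- If the fractional integrals of all test functions are orthogonal to `h`, then the adjoint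
fractional integral of `h` vanishes almost everywhere on the strip. -/
lemma fracAdj_ae_eq_zero (hH : 1 / 2 < H) (hH' : H < 1)
    {h : SpaceTime d → ℝ} (hh : Measurable h) (h2 : MemLp h 2)
    (h0 : ∀ η : TestFn d T, ∫ z, h z * frac H T η z = 0) :
    ∀ᵐ p ∂(volume.restrict (closedStrip d T)), fracAdj H h p = 0 := by
  have hopen := isOpen_openStrip d T
  rw [← volume_restrict_openStrip, ae_restrict_iff' hopen.measurableSet]
  refine hopen.ae_eq_zero_of_integral_contDiff_smul_eq_zero ?_ ?_
  · refine (locallyIntegrableOn_iff hopen.isLocallyClosed).2 fun K hKU hK => ?_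
    -- Local integrability is read off from the duality with the indicator of a compact set.
    have hmem : MemAbsH H T (K.indicator fun _ => (1 : ℝ)) :=
      memAbsH_of_compact hH (measurable_const.indicator hK.measurableSet) (C := 1) (by simp) hK
        (fun p => by by_cases hp : p ∈ K <;> simp [hp]) fun p hp => by simp [hp]
    have h1 := integrable_mul_fracAdj hH hH' hmem hh h2
    rw [IntegrableOn, ← volume_restrict_openStrip] at h1
    have h3 : IntegrableOn (fun p => K.indicator (fun _ => (1 : ℝ)) p * fracAdj H h p) K :=
      IntegrableOn.mono_set h1 hKU
    refine h3.congr_fun (fun p hp => by simp [hp]) hK.measurableSet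
  · intro g hg hgc hgs
    have := integral_mul_fracAdj hH hH' (memAbsH_testFn (T := T) hH ⟨g, hg, hgc, hgs⟩) hh h2
    rw [h0, ← volume_restrict_openStrip] at this
    rw [← this]
    refine (setIntegral_eq_integral_of_forall_compl_eq_zero fun p hp => ?_).symm
    have : g p = 0 := image_eq_zero_of_notMem_tsupport fun h => hp (hgs h)
    simp [this]

/-- The fractional integrals of test functions, as a subspace of `L²`. -/
noncomputable def testSubmodule (d : ℕ) {H : ℝ} (T : ℝ) (hH : 1 / 2 < H) (hH' : H < 1) :
    Submodule ℝ (Lp ℝ 2 (volume : Measure (SpaceTime d))) where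
  carrier := {e | ∃ η : TestFn d T, fracL2 H T η = e}
  add_mem' := by
    rintro _ _ ⟨η, rfl⟩ ⟨ξ, rfl⟩
    refine ⟨η + ξ, ?_⟩
    have e : ⇑(η + ξ : TestFn d T) = fun p => 1 * η p + 1 * ξ p := by ext p; simp
    rw [e, fracL2_linear hH hH' (memAbsH_testFn hH η) (memAbsH_testFn hH ξ) 1 1]
    simp
  zero_mem' := by
    refine ⟨0, ?_⟩
    have e : ⇑(0 : TestFn d T) = fun p => 0 * (0 : TestFn d T) p + 0 * (0 : TestFn d T) p := by ext p; simp
    rw [e, fracL2_linear hH hH' (memAbsH_testFn hH (0 : TestFn d T))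
      (memAbsH_testFn hH (0 : TestFn d T)) 0 0]
    simp
  smul_mem' := by
    rintro c _ ⟨η, rfl⟩
    refine ⟨c • η, ?_⟩
    have e : ⇑(c • η : TestFn d T) = fun p => c * η p + 0 * η p := by ext p; simp
    rw [e, fracL2_linear hH hH' (memAbsH_testFn hH η) (memAbsH_testFn hH η) c 0]
    simp

/-- Test functions are dense in `|𝓗|`: anything orthogonal to them is orthogonal to `|𝓗|`. -/
lemma fracL2_mem_closure (hH : 1 / 2 < H) (hH' : H < 1) (hφ : MemAbsH H T φ) :
    fracL2 H T φ ∈ (testSubmodule d T hH hH').topologicalClosure := by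
  rw [← Submodule.orthogonal_orthogonal_eq_closure, Submodule.mem_orthogonal]
  intro e he
  rw [Submodule.mem_orthogonal] at he
  obtain ⟨h, hh, heh⟩ : ∃ h : SpaceTime d → ℝ, Measurable h ∧ e =ᵐ[volume] h :=
    ⟨_, (Lp.aestronglyMeasurable e).stronglyMeasurable_mk.measurable,
      (Lp.aestronglyMeasurable e).ae_eq_mk⟩
  have h2 : MemLp h 2 := (memLp_congr_ae heh).1 (Lp.memLp e)
  have key : ∀ ψ, MemAbsH H T ψ → inner ℝ e (fracL2 H T ψ) = ∫ z, h z * frac H T ψ z := by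
    intro ψ hψ
    rw [L2.inner_def]
    refine integral_congr_ae ?_
    filter_upwards [heh, hψ.coeFn_fracL2 hH hH'] with z h1 h2
    simp [h1, h2, mul_comm]
  rw [key φ hφ, ← integral_mul_fracAdj hH hH' hφ hh h2]
  refine integral_eq_zero_of_ae ?_
  filter_upwards [fracAdj_ae_eq_zero (T := T) hH hH' hh h2 fun η => by
    rw [← key η (memAbsH_testFn hH η), real_inner_comm]
    exact he _ ⟨η, rfl⟩] with p hp
  simp [hp]

end

/-! ### The stochastic integral -/

section

variable {Ω : Type*} [MeasurableSpace Ω] {P : Measure Ω} {H T : ℝ} {φ ψ : SpaceTime d → ℝ}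
  {F : TestFn d T → Ω → ℝ} {X Y : Ω → ℝ}

lemma innerH_const_pos (hH : 1 / 2 < H) (hH' : H < 1) :
    0 < H * (2 * H - 1) / (fracConst H).toReal :=
  div_pos (mul_pos (by linarith) (by linarith))
    (ENNReal.toReal_pos (fracConst_ne_zero H) (fracConst_ne_top hH hH'))

lemma innerH_sub_self (hH : 1 / 2 < H) (hH' : H < 1) (hφ : MemAbsH H T φ) (hψ : MemAbsH H T ψ) :
    innerH H T (fun p => φ p - ψ p) (fun p => φ p - ψ p) =
      H * (2 * H - 1) / (fracConst H).toReal * ‖fracL2 H T φ - fracL2 H T ψ‖ ^ 2 := by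
  rw [innerH_eq_inner hH hH' (hφ.sub hH hH' hψ) (hφ.sub hH hH' hψ), fracL2_sub hH hH' hφ hψ,
    real_inner_self_eq_norm_sq]

lemma inner_toLp (hX : MemLp X 2 P) (hY : MemLp Y 2 P) :
    inner ℝ (hX.toLp X) (hY.toLp Y) = ∫ ω, X ω * Y ω ∂P := by
  rw [L2.inner_def]
  refine integral_congr_ae ?_
  filter_upwards [hX.coeFn_toLp, hY.coeFn_toLp] with ω h1 h2
  simp [h1, h2, mul_comm]

lemma IsFractionalWhiteNoise.memLp (hF : IsFractionalWhiteNoise H T P F) (η : TestFn d T) :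
    MemLp (F η) 2 P :=
  (hF.gaussian.hasGaussianLaw_eval η).memLp_two

/-- The noise is, up to a constant, an isometry for the `L²` norm of the fractional integrals. -/
lemma IsFractionalWhiteNoise.inner_eq (hF : IsFractionalWhiteNoise H T P F) (hH : 1 / 2 < H)
    (hH' : H < 1) (η ξ : TestFn d T) :
    inner ℝ ((hF.memLp η).toLp (F η)) ((hF.memLp ξ).toLp (F ξ)) =
      H * (2 * H - 1) / (fracConst H).toReal * inner ℝ (fracL2 H T η) (fracL2 H T ξ) := by
  rw [inner_toLp, hF.covariance,
    innerH_eq_inner hH hH' (memAbsH_testFn hH η) (memAbsH_testFn hH ξ)]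

lemma IsFractionalWhiteNoise.norm_sub_sq (hF : IsFractionalWhiteNoise H T P F) (hH : 1 / 2 < H)
    (hH' : H < 1) (η ξ : TestFn d T) :
    ‖(hF.memLp η).toLp (F η) - (hF.memLp ξ).toLp (F ξ)‖ ^ 2 =
      H * (2 * H - 1) / (fracConst H).toReal * ‖fracL2 H T η - fracL2 H T ξ‖ ^ 2 := by
  rw [norm_sub_sq_real, norm_sub_sq_real, ← real_inner_self_eq_norm_sq,
    ← real_inner_self_eq_norm_sq, ← real_inner_self_eq_norm_sq, ← real_inner_self_eq_norm_sq,
    hF.inner_eq hH hH', hF.inner_eq hH hH', hF.inner_eq hH hH']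
  ring

lemma tendsto_innerH_iff (hH : 1 / 2 < H) (hH' : H < 1) (hφ : MemAbsH H T φ)
    (φn : ℕ → TestFn d T) :
    Tendsto (fun n => innerH H T (fun p => φn n p - φ p) (fun p => φn n p - φ p)) atTop (𝓝 0) ↔
      Tendsto (fun n => fracL2 H T (φn n)) atTop (𝓝 (fracL2 H T φ)) := by
  simp_rw [innerH_sub_self hH hH' (memAbsH_testFn hH _) hφ]
  have hc := innerH_const_pos hH hH'
  rw [tendsto_iff_norm_sub_tendsto_zero (b := fracL2 H T φ)]
  generalize H * (2 * H - 1) / (fracConst H).toReal = c at hc ⊢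
  constructor
  · intro h
    have h1 := (h.const_mul c⁻¹).sqrt
    simpa only [inv_mul_cancel_left₀ hc.ne', Real.sqrt_sq (norm_nonneg _), mul_zero,
      Real.sqrt_zero] using h1
  · intro h
    simpa using (h.pow 2).const_mul c

lemma isStochIntegral_iff (hF : IsFractionalWhiteNoise H T P F) (hH : 1 / 2 < H)
    (hH' : H < 1) :
    IsStochIntegral H T P F φ X ↔ MemAbsH H T φ ∧ ∃ hX : MemLp X 2 P, ∃ φn : ℕ → TestFn d T,
      Tendsto (fun n => fracL2 H T (φn n)) atTop (𝓝 (fracL2 H T φ)) ∧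
      Tendsto (fun n => (hF.memLp (φn n)).toLp (F (φn n))) atTop (𝓝 (hX.toLp X)) := by
  constructor
  · rintro ⟨h1, h2, φn, h3, h4⟩
    refine ⟨h1, h2, φn, (tendsto_innerH_iff hH hH' h1 φn).1 h3, ?_⟩
    exact (Lp.tendsto_Lp_iff_tendsto_eLpNorm'' _ (fun n => hF.memLp (φn n)) _ h2).2 h4
  · rintro ⟨h1, h2, φn, h3, h4⟩
    refine ⟨h1, h2, φn, (tendsto_innerH_iff hH hH' h1 φn).2 h3, ?_⟩
    exact (Lp.tendsto_Lp_iff_tendsto_eLpNorm'' _ (fun n => hF.memLp (φn n)) _ h2).1 h4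

/-- The isometry property of the stochastic integral. -/
lemma IsStochIntegral.integral_mul (hF : IsFractionalWhiteNoise H T P F) (hH : 1 / 2 < H)
    (hH' : H < 1) (hX : IsStochIntegral H T P F φ X) (hY : IsStochIntegral H T P F ψ Y) :
    ∫ ω, X ω * Y ω ∂P = innerH H T φ ψ := by
  obtain ⟨h1, h2, φn, h3, h4⟩ := (isStochIntegral_iff hF hH hH').1 hX
  obtain ⟨k1, k2, ψn, k3, k4⟩ := (isStochIntegral_iff hF hH hH').1 hY
  rw [innerH_eq_inner hH hH' h1 k1, ← inner_toLp h2 k2]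
  refine tendsto_nhds_unique (h4.inner k4) ?_
  simp_rw [hF.inner_eq hH hH']
  exact (h3.inner k3).const_mul _

/-- Uniqueness of the stochastic integral: by the isometry, the squared distance of two versions is
`⟨φ,φ⟩ - 2⟨φ,φ⟩ + ⟨φ,φ⟩ = 0`. -/
lemma IsStochIntegral.ae_eq (hF : IsFractionalWhiteNoise H T P F) (hH : 1 / 2 < H)
    (hH' : H < 1) (hX : IsStochIntegral H T P F φ X) (hY : IsStochIntegral H T P F φ Y) :
    X =ᵐ[P] Y := by
  rw [← MemLp.toLp_eq_toLp_iff hX.memLp hY.memLp, ← sub_eq_zero, ← norm_eq_zero,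
    ← sq_eq_zero_iff, norm_sub_sq_real, ← real_inner_self_eq_norm_sq,
    ← real_inner_self_eq_norm_sq, inner_toLp, inner_toLp, inner_toLp,
    hX.integral_mul hF hH hH' hX, hX.integral_mul hF hH hH' hY, hY.integral_mul hF hH hH' hY]
  ring

/-- Existence of the stochastic integral: the images of an approximating sequence of test functions
form a Cauchy sequence in `L²(Ω)`. -/
lemma exists_isStochIntegral (hF : IsFractionalWhiteNoise H T P F) (hH : 1 / 2 < H)
    (hH' : H < 1) (hφ : MemAbsH H T φ) : ∃ X, IsStochIntegral H T P F φ X := by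
  have hcl := fracL2_mem_closure hH hH' hφ
  rw [← SetLike.mem_coe, Submodule.topologicalClosure_coe, mem_closure_iff_seq_limit] at hcl
  obtain ⟨e, he, hlim⟩ := hcl
  choose φn hφn using he
  obtain rfl : (fun n => fracL2 H T (φn n)) = e := funext hφn
  have hc := innerH_const_pos hH hH'
  have hdist : ∀ m n, dist ((hF.memLp (φn m)).toLp (F (φn m)))
      ((hF.memLp (φn n)).toLp (F (φn n))) =
      √(H * (2 * H - 1) / (fracConst H).toReal) *
        dist (fracL2 H T (φn m)) (fracL2 H T (φn n)) := by
    intro m n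
    rw [dist_eq_norm, dist_eq_norm, ← Real.sqrt_sq (norm_nonneg (_ - _)),
      hF.norm_sub_sq hH hH', Real.sqrt_mul hc.le, Real.sqrt_sq (norm_nonneg _)]
  have hcau : CauchySeq fun n => (hF.memLp (φn n)).toLp (F (φn n)) := by
    refine Metric.cauchySeq_iff.2 fun ε hε => ?_
    have hs := Real.sqrt_pos.2 hc
    obtain ⟨N, hN⟩ := Metric.cauchySeq_iff.1 hlim.cauchySeq _ (div_pos hε hs)
    refine ⟨N, fun m hm n hn => ?_⟩
    rw [hdist, mul_comm]
    exact (lt_div_iff₀ hs).1 (hN m hm n hn)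
  obtain ⟨x, hx⟩ := cauchySeq_tendsto_of_complete hcau
  refine ⟨x, (isStochIntegral_iff hF hH hH').2 ⟨hφ, Lp.memLp x, φn, hlim, ?_⟩⟩
  rwa [Lp.toLp_coeFn]

lemma stochIntegralWellDefined (hF : IsFractionalWhiteNoise H T P F) (hH : 1 / 2 < H)
    (hH' : H < 1) (hφ : MemAbsH H T φ) : StochIntegralWellDefined H T P F φ := by
  obtain ⟨X, hX⟩ := exists_isStochIntegral hF hH hH' hφ
  exact ⟨X, hX, fun X' hX' => hX'.ae_eq hF hH hH' hX⟩

lemma isStochIntegral_stochIntegral (hF : IsFractionalWhiteNoise H T P F) (hH : 1 / 2 < H)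
    (hH' : H < 1) (hφ : MemAbsH H T φ) :
    IsStochIntegral H T P F φ (stochIntegral H T P F φ) := by
  have h := exists_isStochIntegral hF hH hH' hφ
  rw [stochIntegral, dif_pos h]
  exact h.choose_spec

end

/-! ### Jointly measurable modifications -/

lemma ae_tendsto_of_tsum_eLpNorm {Ω : Type*} [MeasurableSpace Ω] {P : Measure Ω}
    [IsProbabilityMeasure P] {f : ℕ → Ω → ℝ} {g : Ω → ℝ}
    (hf : ∀ n, AEStronglyMeasurable (f n) P) (hg : AEStronglyMeasurable g P)
    (h : ∑' n, eLpNorm (f n - g) 2 P ≠ ∞) :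
    ∀ᵐ ω ∂P, Tendsto (fun n => f n ω) atTop (𝓝 (g ω)) := by
  have h1 : ∫⁻ ω, ∑' n, ‖(f n - g) ω‖ₑ ∂P ≠ ∞ := by
    rw [lintegral_tsum fun n => ((hf n).sub hg).enorm]
    refine ne_top_of_le_ne_top h (ENNReal.tsum_le_tsum fun n => ?_)
    rw [← eLpNorm_one_eq_lintegral_enorm]
    exact eLpNorm_le_eLpNorm_of_exponent_le (by norm_num) ((hf n).sub hg)
  have hm : AEMeasurable (fun ω => ∑' n, ‖(f n - g) ω‖ₑ) P :=
    AEMeasurable.tsum fun n => ((hf n).sub hg).enorm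
  filter_upwards [ae_lt_top' hm h1] with ω hω
  have h2 := ENNReal.tendsto_atTop_zero_of_tsum_ne_top hω.ne
  rw [tendsto_iff_edist_tendsto_0]
  simpa [edist_eq_enorm_sub] using h2

/-- A family of square-integrable random variables that is Lipschitz with respect to a measurable
pseudo-metric induced by a map into a separable metric space has a jointly measurable modification.
No continuity of the map is required: the index set is cut into countably many measurable pieces
on which the map is almost constant. -/
theorem exists_measurable_modification {Ω S A : Type*} [MeasurableSpace Ω] {P : Measure Ω}
    [IsProbabilityMeasure P] [MeasurableSpace S] [PseudoMetricSpace A]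
    [SecondCountableTopology A] (e : S → A) (he : ∀ q, Measurable fun p => dist (e p) (e q))
    (Z : S → Ω → ℝ) (hZ : ∀ p, AEStronglyMeasurable (Z p) P) (C : ℝ) (hC : 0 ≤ C)
    (hd : ∀ p q, eLpNorm (Z p - Z q) 2 P ≤ ENNReal.ofReal (C * dist (e p) (e q))) :
    ∃ Y : S → Ω → ℝ, Measurable (fun q : S × Ω => Y q.1 q.2) ∧ ∀ p, Y p =ᵐ[P] Z p := by
  classical
  rcases isEmpty_or_nonempty S with hS | hS
  · exact ⟨Z, measurable_of_empty _, fun p => isEmptyElim p⟩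
  obtain ⟨u, hu⟩ := TopologicalSpace.exists_dense_seq (range e)
  choose q hq using fun k => (u k).2
  have hex : ∀ (n : ℕ) (p : S), ∃ k, dist (e p) (e (q k)) < (1 / 2) ^ n := by
    intro n p
    obtain ⟨k, hk⟩ := hu.exists_dist_lt ⟨e p, p, rfl⟩ (ε := (1 / 2) ^ n) (by positivity)
    exact ⟨k, by rw [hq]; exact hk⟩
  -- `N n p` is the first point of the dense sequence within `(1/2)^n` of `e p`.
  let N : ℕ → S → ℕ := fun n p => Nat.find (hex n p)
  have hN : ∀ n, Measurable (N n) := fun n => measurable_find _ fun k =>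
    measurableSet_lt (he (q k)) measurable_const
  have hNs : ∀ n p, dist (e p) (e (q (N n p))) < (1 / 2) ^ n := fun n p => Nat.find_spec (hex n p)
  let Z' : ℕ → Ω → ℝ := fun k => (hZ (q k)).mk
  have hZ' : Measurable fun r : ℕ × Ω => Z' r.1 r.2 :=
    measurable_from_prod_countable_right fun k => (hZ (q k)).stronglyMeasurable_mk.measurable
  let Yn : ℕ → S × Ω → ℝ := fun n r => Z' (N n r.1) r.2
  have hYn : ∀ n, Measurable (Yn n) := fun n =>
    hZ'.comp (((hN n).comp measurable_fst).prodMk measurable_snd)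
  -- The limit superior is measurable everywhere and agrees with the limit where the latter exists.
  refine ⟨fun p ω => limsup (fun n => Yn n (p, ω)) atTop, Measurable.limsup hYn, fun p => ?_⟩
  have hlim : ∀ᵐ ω ∂P, Tendsto (fun n => Yn n (p, ω)) atTop (𝓝 (Z p ω)) := by
    refine ae_tendsto_of_tsum_eLpNorm (f := fun n ω => Yn n (p, ω))
      (fun n => (hZ (q (N n p))).stronglyMeasurable_mk.aestronglyMeasurable) (hZ p) ?_
    have hb : ∀ n, eLpNorm ((fun ω => Yn n (p, ω)) - Z p) 2 P ≤
        ENNReal.ofReal (C * (1 / 2) ^ n) := by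
      intro n
      have : (fun ω => Yn n (p, ω)) - Z p =ᵐ[P] Z (q (N n p)) - Z p :=
        ((hZ (q (N n p))).ae_eq_mk.symm).sub (ae_eq_refl _)
      rw [eLpNorm_congr_ae this]
      refine (hd _ _).trans (ENNReal.ofReal_le_ofReal (mul_le_mul_of_nonneg_left ?_ hC))
      rw [dist_comm]
      exact (hNs n p).le
    have hs : Summable fun n : ℕ => C * (1 / 2 : ℝ) ^ n :=
      (summable_geometric_of_lt_one (by norm_num) (by norm_num)).mul_left C
    refine ne_top_of_le_ne_top ?_ (ENNReal.tsum_le_tsum hb)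
    rw [← ENNReal.ofReal_tsum_of_nonneg (fun n => by positivity) hs]
    exact ENNReal.ofReal_ne_top
  filter_upwards [hlim] with ω hω using hω.limsup_eq

/-! ### The heat kernel and its energy -/

lemma heatKernel_nonneg (t : ℝ) (x : EuclideanSpace ℝ (Fin d)) : 0 ≤ heatKernel t x := by
  unfold heatKernel
  split_ifs with h
  · positivity
  · exact le_rfl

@[fun_prop]
lemma measurable_heatKernel :
    Measurable fun q : SpaceTime d => heatKernel q.1 q.2 := by
  unfold heatKernel
  exact Measurable.ite (measurableSet_lt measurable_const measurable_fst) (by fun_prop)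
    (by fun_prop)

lemma measurable_gKernel (t : ℝ) (x : EuclideanSpace ℝ (Fin d)) : Measurable (gKernel t x) :=
  measurable_heatKernel.comp
    (by fun_prop : Measurable fun p : SpaceTime d => ((t - p.1, x - p.2) : SpaceTime d))

lemma measurable_gKernel_prod :
    Measurable fun r : SpaceTime d × SpaceTime d => gKernel r.1.1 r.1.2 r.2 :=
  measurable_heatKernel.comp (by fun_prop : Measurable fun r : SpaceTime d × SpaceTime d =>
    ((r.1.1 - r.2.1, r.1.2 - r.2.2) : SpaceTime d))

lemma enorm_heatKernel (t : ℝ) (x : EuclideanSpace ℝ (Fin d)) :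
    ‖heatKernel t x‖ₑ = ENNReal.ofReal (heatKernel t x) := by
  rw [← ofReal_norm, Real.norm_of_nonneg (heatKernel_nonneg t x)]

lemma lintegral_exp_neg_mul_sq {b : ℝ} (hb : 0 < b) :
    ∫⁻ x : EuclideanSpace ℝ (Fin d), ENNReal.ofReal (Real.exp (-b * ‖x‖ ^ 2)) =
      ENNReal.ofReal ((Real.pi / b) ^ ((d : ℝ) / 2)) := by
  have h := GaussianFourier.integral_rexp_neg_mul_sq_norm (V := EuclideanSpace ℝ (Fin d)) hb
  rw [finrank_euclideanSpace_fin] at h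
  rw [← h, ofReal_integral_eq_lintegral_ofReal _ (ae_of_all _ fun x => (Real.exp_pos _).le)]
  refine not_imp_comm.1 integral_undef ?_
  rw [h]
  have := Real.pi_pos
  positivity

lemma lintegral_heatKernel {t : ℝ} (ht : 0 < t) :
    ∫⁻ x : EuclideanSpace ℝ (Fin d), ENNReal.ofReal (heatKernel t x) = 1 := by
  have h1 : ∀ x : EuclideanSpace ℝ (Fin d), ENNReal.ofReal (heatKernel t x) =
      ENNReal.ofReal ((4 * Real.pi * t) ^ (-(d : ℝ) / 2)) *
        ENNReal.ofReal (Real.exp (-(1 / (4 * t)) * ‖x‖ ^ 2)) := by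
    intro x
    rw [heatKernel, if_pos ht, ENNReal.ofReal_mul (by positivity)]
    congr 3
    ring
  simp_rw [h1]
  have hp : 0 < 4 * Real.pi * t := by positivity
  rw [lintegral_const_mul _ (by fun_prop), lintegral_exp_neg_mul_sq (by positivity),
    ← ENNReal.ofReal_mul (by positivity),
    show Real.pi / (1 / (4 * t)) = 4 * Real.pi * t by field_simp, ← Real.rpow_add hp]
  simp [neg_div]

lemma lintegral_heatKernel_le (t : ℝ) :
    ∫⁻ x : EuclideanSpace ℝ (Fin d), ENNReal.ofReal (heatKernel t x) ≤ 1 := by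
  by_cases ht : 0 < t
  · exact (lintegral_heatKernel ht).le
  · simp [heatKernel, ht]

lemma lintegral_heatKernel_sub_le (t : ℝ) (a : EuclideanSpace ℝ (Fin d)) :
    ∫⁻ x, ENNReal.ofReal (heatKernel t (a - x)) ≤ 1 := by
  rw [lintegral_sub_left_eq_self (fun x => ENNReal.ofReal (heatKernel t x)) a]
  exact lintegral_heatKernel_le t

lemma lintegral_heatKernel_mul {r s : ℝ} (hr : 0 < r) (hs : 0 < s) :
    ∫⁻ x : EuclideanSpace ℝ (Fin d), ENNReal.ofReal (heatKernel r x) *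
      ENNReal.ofReal (heatKernel s x) =
      ENNReal.ofReal ((4 * Real.pi * (r + s)) ^ (-(d : ℝ) / 2)) := by
  have h1 : ∀ x : EuclideanSpace ℝ (Fin d), ENNReal.ofReal (heatKernel r x) *
      ENNReal.ofReal (heatKernel s x) =
      ENNReal.ofReal ((4 * Real.pi * r) ^ (-(d : ℝ) / 2) * (4 * Real.pi * s) ^ (-(d : ℝ) / 2)) *
        ENNReal.ofReal (Real.exp (-((r + s) / (4 * r * s)) * ‖x‖ ^ 2)) := by
    intro x
    rw [heatKernel, if_pos hr, heatKernel, if_pos hs, ← ENNReal.ofReal_mul (by positivity),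
      ← ENNReal.ofReal_mul (by positivity), mul_mul_mul_comm, ← Real.exp_add]
    congr 3
    field_simp
    ring
  simp_rw [h1]
  have hp := Real.pi_pos
  rw [lintegral_const_mul _ (by fun_prop), lintegral_exp_neg_mul_sq (by positivity),
    ← ENNReal.ofReal_mul (by positivity), neg_div, Real.rpow_neg (by positivity),
    Real.rpow_neg (by positivity), Real.rpow_neg (by positivity), ← Real.inv_rpow (by positivity),
    ← Real.inv_rpow (by positivity), ← Real.inv_rpow (by positivity),
    ← Real.mul_rpow (by positivity) (by positivity),
    ← Real.mul_rpow (by positivity) (by positivity)]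
  congr 2
  field_simp

/-- The energy of the heat kernel up to time `t`, after the spatial integration. -/
noncomputable def heatEnergy (d : ℕ) (H t : ℝ) : ℝ≥0∞ :=
  ∫⁻ r in Ioc 0 t, ∫⁻ s in Ioc 0 t, ENNReal.ofReal ((4 * Real.pi * (r + s)) ^ (-(d : ℝ) / 2)) *
    ENNReal.ofReal (|r - s| ^ (2 * H - 2))

/-- The spatial integration uses the semigroup property of the heat kernel. The assumption `t ≤ T`
ensures that the whole support of `g_{tx}` in time is seen by the energy. -/
lemma energy_gKernel {H T t : ℝ} (ht : t ≤ T) (x : EuclideanSpace ℝ (Fin d)) :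
    energy H T (fun p => ‖gKernel t x p‖ₑ) (fun p => ‖gKernel t x p‖ₑ) = heatEnergy d H t := by
  have hx : ∀ u v : ℝ, ∫⁻ y, ‖gKernel t x (u, y)‖ₑ * ‖gKernel t x (v, y)‖ₑ *
      ENNReal.ofReal (|u - v| ^ (2 * H - 2)) =
      (Ioi 0).indicator (fun r => (Ioi 0).indicator (fun s =>
        ENNReal.ofReal ((4 * Real.pi * (r + s)) ^ (-(d : ℝ) / 2)) *
          ENNReal.ofReal (|r - s| ^ (2 * H - 2))) (t - v)) (t - u) := by
    intro u v
    by_cases hu : 0 < t - u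
    · by_cases hv : 0 < t - v
      · have hm : ∀ w, Measurable fun y => ‖gKernel t x (w, y)‖ₑ := fun w =>
          ((measurable_gKernel t x).comp measurable_prodMk_left).enorm
        rw [indicator_of_mem (mem_Ioi.2 hu), indicator_of_mem (mem_Ioi.2 hv),
          lintegral_mul_const (f := fun y => ‖gKernel t x (u, y)‖ₑ * ‖gKernel t x (v, y)‖ₑ) _
            ((hm u).mul (hm v))]
        simp only [gKernel, enorm_heatKernel]
        rw [lintegral_sub_left_eq_self (fun y => ENNReal.ofReal (heatKernel (t - u) y) *
          ENNReal.ofReal (heatKernel (t - v) y)) x, lintegral_heatKernel_mul hu hv, abs_sub_comm]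
        congr 4
        ring
      · simp [gKernel, heatKernel, indicator, hv]
    · simp [gKernel, heatKernel, indicator, hu]
  have hI : ∀ f : ℝ → ℝ≥0∞, ∫⁻ u in Icc 0 T, (Ioi 0).indicator f (t - u) =
      ∫⁻ r in Ioc 0 t, f r := by
    intro f
    rw [← lintegral_indicator measurableSet_Icc, ← lintegral_indicator measurableSet_Ioc,
      ← lintegral_sub_left_eq_self ((Ioc 0 t).indicator f) t]
    refine lintegral_congr_ae ?_
    filter_upwards [ae_fst_ne (μ := volume) 0] with u hu
    by_cases h : t - u ∈ Ioc 0 t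
    · have hu' : u ∈ Icc 0 T := ⟨by linarith [h.2], by linarith [h.1]⟩
      rw [indicator_of_mem h, indicator_of_mem hu', indicator_of_mem (mem_Ioi.2 h.1)]
    · rw [indicator_of_notMem h]
      by_cases h' : u ∈ Icc 0 T
      · rw [indicator_of_mem h', indicator_of_notMem]
        exact fun h2 => h ⟨h2, by linarith [h'.1]⟩
      · rw [indicator_of_notMem h']
  simp only [energy, hx, heatEnergy]
  rw [← hI]
  refine lintegral_congr fun u => ?_
  by_cases hu : t - u ∈ Ioi (0 : ℝ)
  · simp only [indicator_of_mem hu]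
    exact hI _
  · simp [indicator_of_notMem hu]

lemma heatEnergy_mono {H t t' : ℝ} (h : t ≤ t') : heatEnergy d H t ≤ heatEnergy d H t' := by
  unfold heatEnergy
  have hs : Ioc 0 t ⊆ Ioc 0 t' := Ioc_subset_Ioc_right h
  exact (lintegral_mono_set hs).trans (lintegral_mono fun r => lintegral_mono_set hs)

lemma lintegral_Ioc_rpow {a s : ℝ} (ha : -1 < a) (hs : 0 < s) :
    ∫⁻ r in Ioc 0 s, ENNReal.ofReal (r ^ a) = ENNReal.ofReal (s ^ (a + 1) / (a + 1)) := by
  have h1 : IntegrableOn (fun r : ℝ => r ^ a) (Ioc 0 s) :=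
    (intervalIntegrable_iff_integrableOn_Ioc_of_le hs.le).1
      (intervalIntegral.intervalIntegrable_rpow' ha)
  rw [← ofReal_integral_eq_lintegral_ofReal h1, ← intervalIntegral.integral_of_le hs.le,
    integral_rpow (Or.inl ha), Real.zero_rpow (by linarith), sub_zero]
  filter_upwards [ae_restrict_mem measurableSet_Ioc] with r hr
  exact Real.rpow_nonneg hr.1.le _

lemma lintegral_Ioc_sub_rpow (a : ℝ) {s t : ℝ} (hs : s ∈ Ioc 0 t) :
    ∫⁻ r in Ioc 0 t, (Iio s).indicator (fun r => ENNReal.ofReal (|r - s| ^ a)) r =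
      ∫⁻ r in Ioc 0 s, ENNReal.ofReal (r ^ a) := by
  rw [← lintegral_indicator measurableSet_Ioc, ← lintegral_indicator measurableSet_Ioc,
    ← lintegral_sub_left_eq_self ((Ioc 0 s).indicator fun r => ENNReal.ofReal (r ^ a)) s]
  refine lintegral_congr_ae ?_
  filter_upwards [ae_fst_ne (μ := volume) 0] with r hr
  by_cases h1 : r ∈ Ioo 0 s
  · have h2 : r ∈ Ioc 0 t := ⟨h1.1, h1.2.le.trans hs.2⟩
    have h3 : s - r ∈ Ioc 0 s := ⟨by linarith [h1.2], by linarith [h1.1]⟩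
    rw [indicator_of_mem h2, indicator_of_mem (mem_Iio.2 h1.2), indicator_of_mem h3, abs_sub_comm,
      abs_of_pos]
    linarith [h1.2]
  · rw [indicator_of_notMem (a := s - r)
      fun h => h1 ⟨lt_of_le_of_ne (by linarith [h.2]) hr, by linarith [h.1]⟩]
    by_cases h2 : r ∈ Ioc 0 t
    · rw [indicator_of_mem h2, indicator_of_notMem]
      exact fun h3 => h1 ⟨h2.1, h3⟩
    · rw [indicator_of_notMem h2]

/-- The energy of the heat kernel is finite above the critical Hurst index. -/
lemma heatEnergy_lt_top {H : ℝ} (hH : 1 / 2 < H) (hd : (d : ℝ) / 4 < H) (t : ℝ) :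
    heatEnergy d H t < ∞ := by
  -- `A r s` is the part `r < s` of the integrand, with `r + s` bounded below by `s`.
  set A : ℝ → ℝ → ℝ≥0∞ := fun r s => ENNReal.ofReal (s ^ (-(d : ℝ) / 2)) *
    (Iio s).indicator (fun r => ENNReal.ofReal (|r - s| ^ (2 * H - 2))) r with hA
  have hAm : Measurable fun q : ℝ × ℝ => A q.1 q.2 := by
    have : (fun q : ℝ × ℝ => A q.1 q.2) = fun q : ℝ × ℝ => ENNReal.ofReal (q.2 ^ (-(d : ℝ) / 2)) *
        ({q : ℝ × ℝ | q.1 < q.2}).indicator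
          (fun q => ENNReal.ofReal (|q.1 - q.2| ^ (2 * H - 2))) q := by
      ext q
      simp [hA, indicator]
    rw [this]
    exact (by fun_prop : Measurable fun q : ℝ × ℝ => ENNReal.ofReal (q.2 ^ (-(d : ℝ) / 2))).mul
      (Measurable.indicator (by fun_prop) (measurableSet_lt measurable_fst measurable_snd))
  have hpi : 1 ≤ 4 * Real.pi := by linarith [Real.pi_gt_three]
  have hle : ∀ r s : ℝ, 0 < r → 0 < s → s ≤ r →
      ENNReal.ofReal ((4 * Real.pi * (r + s)) ^ (-(d : ℝ) / 2)) ≤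
        ENNReal.ofReal (r ^ (-(d : ℝ) / 2)) := by
    intro r s hr hs _
    refine ENNReal.ofReal_le_ofReal (Real.rpow_le_rpow_of_nonpos hr ?_ ?_)
    · nlinarith
    · have : (0 : ℝ) ≤ d := Nat.cast_nonneg d
      linarith
  have hB : ∫⁻ s in Ioc 0 t, ∫⁻ r in Ioc 0 t, A r s < ∞ := by
    have h1 : ∀ s ∈ Ioc 0 t, ∫⁻ r in Ioc 0 t, A r s =
        ENNReal.ofReal (1 / (2 * H - 1)) * ENNReal.ofReal (s ^ (2 * H - 1 - (d : ℝ) / 2)) := by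
      intro s hs
      have h2H : 0 < 2 * H - 1 := by linarith
      simp only [hA]
      rw [lintegral_const_mul' _ _ (by simp), lintegral_Ioc_sub_rpow _ hs,
        lintegral_Ioc_rpow (by linarith) hs.1, ← ENNReal.ofReal_mul (Real.rpow_nonneg hs.1.le _),
        ← ENNReal.ofReal_mul (by positivity)]
      congr 1
      have e : s ^ (2 * H - 1 - (d : ℝ) / 2) = s ^ (-(d : ℝ) / 2) * s ^ (2 * H - 2 + 1) := by
        rw [← Real.rpow_add hs.1]
        congr 1
        ring
      rw [e, show 2 * H - 2 + 1 = 2 * H - 1 by ring]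
      generalize s ^ (2 * H - 1) = y
      ring
    rw [setLIntegral_congr_fun measurableSet_Ioc h1, lintegral_const_mul' _ _ (by simp)]
    exact ENNReal.mul_lt_top (by simp) (lintegral_Ioc_rpow_lt_top (by linarith) t)
  refine lt_of_le_of_lt (b := ∫⁻ r in Ioc 0 t, ∫⁻ s in Ioc 0 t, (A r s + A s r)) ?_ ?_
  · refine setLIntegral_mono' measurableSet_Ioc fun r hr => ?_
    refine setLIntegral_mono_ae' measurableSet_Ioc ?_
    filter_upwards [ae_fst_ne (μ := volume) r] with s hrs hs
    rcases lt_or_gt_of_ne hrs with h | h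
    · refine le_add_right ?_
      simp only [hA]
      rw [indicator_of_mem (mem_Iio.2 h), add_comm r s]
      exact mul_le_mul_left (hle s r hs.1 hr.1 h.le) _
    · refine le_add_left ?_
      simp only [hA]
      rw [indicator_of_mem (mem_Iio.2 h), abs_sub_comm s r]
      exact mul_le_mul_left (hle r s hr.1 hs.1 h.le) _
  · have h2 : ∀ r : ℝ, ∫⁻ s in Ioc 0 t, (A r s + A s r) =
        (∫⁻ s in Ioc 0 t, A r s) + ∫⁻ s in Ioc 0 t, A s r := fun r =>
      lintegral_add_left (hAm.comp measurable_prodMk_left) _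
    simp_rw [h2]
    rw [lintegral_add_right _ (Measurable.lintegral_prod_left' hAm),
      lintegral_lintegral_swap hAm.aemeasurable]
    exact ENNReal.add_lt_top.2 ⟨hB, hB⟩

/-- The energy of the heat kernel is infinite at and below the critical Hurst index. Here
`|r - s| ≤ r + s` reduces the energy to a power of `r + s`. -/
lemma heatEnergy_eq_top {H : ℝ} (hH' : H < 1) (hd : H ≤ (d : ℝ) / 4) {t : ℝ} (ht : 0 < t) :
    heatEnergy d H t = ∞ := by
  have hp := Real.pi_pos
  have hd0 : (0 : ℝ) ≤ d := Nat.cast_nonneg d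
  set c : ℝ := 2 ^ (2 * H - 2) * (8 * Real.pi) ^ (-(d : ℝ) / 2) with hc
  have hc0 : 0 < c := by positivity
  have hle : ∫⁻ r in Ioc 0 t, ENNReal.ofReal (c * r ^ (2 * H - 1 - (d : ℝ) / 2)) ≤
      heatEnergy d H t := by
    refine setLIntegral_mono' measurableSet_Ioc fun r hr => ?_
    have hr0 := hr.1
    refine le_trans ?_ (lintegral_mono_set (Ioc_subset_Ioc_right hr.2))
    have h1 : ∫⁻ s in Ioc 0 r, ENNReal.ofReal (c * r ^ (2 * H - 2 - (d : ℝ) / 2)) =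
        ENNReal.ofReal (c * r ^ (2 * H - 1 - (d : ℝ) / 2)) := by
      rw [setLIntegral_const, Real.volume_Ioc, sub_zero, ← ENNReal.ofReal_mul (by positivity),
        show 2 * H - 1 - (d : ℝ) / 2 = 2 * H - 2 - (d : ℝ) / 2 + 1 by ring,
        Real.rpow_add_one hr0.ne', mul_assoc]
    rw [← h1]
    refine setLIntegral_mono_ae' measurableSet_Ioc ?_
    filter_upwards [ae_fst_ne (μ := volume) r] with s hrs hs
    have hs0 := hs.1
    rw [← ENNReal.ofReal_mul (by positivity)]
    refine ENNReal.ofReal_le_ofReal ?_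
    have e1 : c * r ^ (2 * H - 2 - (d : ℝ) / 2) =
        (8 * Real.pi * r) ^ (-(d : ℝ) / 2) * (2 * r) ^ (2 * H - 2) := by
      rw [Real.mul_rpow (by positivity) hr0.le, Real.mul_rpow (by positivity) hr0.le,
        show 2 * H - 2 - (d : ℝ) / 2 = -(d : ℝ) / 2 + (2 * H - 2) by ring, Real.rpow_add hr0, hc]
      ring
    rw [e1]
    refine mul_le_mul (Real.rpow_le_rpow_of_nonpos (by positivity) ?_ (by linarith))
      (Real.rpow_le_rpow_of_nonpos (abs_pos.2 (sub_ne_zero.2 hrs)) ?_ (by linarith))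
      (by positivity) (by positivity)
    · nlinarith [hs.2]
    · rw [abs_le]; constructor <;> linarith [hs.2]
  by_contra hfin
  have hlt := lt_of_le_of_lt hle (lt_top_iff_ne_top.2 hfin)
  have hint : IntegrableOn (fun r : ℝ => c * r ^ (2 * H - 1 - (d : ℝ) / 2)) (Ioc 0 t) := by
    refine ⟨by fun_prop, ?_⟩
    rw [hasFiniteIntegral_iff_ofReal]
    · exact hlt
    · filter_upwards [ae_restrict_mem measurableSet_Ioc] with r hr
      have := hr.1
      positivity
  have h2 : IntegrableOn (fun r : ℝ => r ^ (2 * H - 1 - (d : ℝ) / 2)) (Ioo 0 t) := by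
    have := (hint.mono_set Ioo_subset_Ioc_self).const_mul c⁻¹
    simpa [inv_mul_cancel_left₀ hc0.ne', IntegrableOn] using this
  have := (intervalIntegral.integrableOn_Ioo_rpow_iff ht).1 h2
  linarith

lemma memAbsH_gKernel {H T t : ℝ} (hH : 1 / 2 < H) (hd : (d : ℝ) / 4 < H) (ht : t ≤ T)
    (x : EuclideanSpace ℝ (Fin d)) : MemAbsH H T (gKernel t x) := by
  refine memAbsH_iff.2 ⟨measurable_gKernel t x, ?_⟩
  rw [energy_gKernel ht]
  exact heatEnergy_lt_top hH hd t

/-! ### Test functions convolved with the reflected heat kernel -/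

section

variable {H T : ℝ} {ψ : SpaceTime d → ℝ}

lemma measurableSet_closedStrip (d : ℕ) (T : ℝ) : MeasurableSet (closedStrip d T) :=
  measurableSet_Icc.prod MeasurableSet.univ

lemma testFn_eq_zero (η : TestFn d T) {p : SpaceTime d} (hp : p ∉ closedStrip d T) : η p = 0 :=
  image_eq_zero_of_notMem_tsupport fun h => hp ⟨Ioo_subset_Icc_self (η.tsupport_subset h).1, trivial⟩

lemma integrable_testFn (η : TestFn d T) : Integrable η :=
  η.continuous.integrable_of_hasCompactSupport η.hasCompactSupport

lemma lintegral_testFn_mul_gKernel_le (η : TestFn d T) {C : ℝ} (hC : ∀ p, ‖η p‖ ≤ C)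
    (p : SpaceTime d) :
    ∫⁻ q in closedStrip d T, ‖η q * gKernel q.1 q.2 p‖ₑ ≤ ENNReal.ofReal C * ENNReal.ofReal T := by
  have hm : Measurable fun q : SpaceTime d => ENNReal.ofReal (heatKernel (q.1 - p.1) (q.2 - p.2)) :=
    (measurable_heatKernel.comp (by fun_prop : Measurable fun q : SpaceTime d =>
      ((q.1 - p.1, q.2 - p.2) : SpaceTime d))).ennreal_ofReal
  calc ∫⁻ q in closedStrip d T, ‖η q * gKernel q.1 q.2 p‖ₑ
      ≤ ∫⁻ q in closedStrip d T, ENNReal.ofReal C *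
          ENNReal.ofReal (heatKernel (q.1 - p.1) (q.2 - p.2)) := by
        refine lintegral_mono fun q => ?_
        rw [enorm_mul, gKernel, enorm_heatKernel, ← ofReal_norm]
        gcongr
        exact hC q
    _ = ENNReal.ofReal C * ∫⁻ t in Icc 0 T, ∫⁻ x,
          ENNReal.ofReal (heatKernel (t - p.1) (x - p.2)) := by
        rw [lintegral_const_mul _ hm, volume_restrict_closedStrip,
          lintegral_prod _ hm.aemeasurable]
    _ ≤ ENNReal.ofReal C * ∫⁻ t in Icc 0 T, 1 := by
        gcongr with t
        rw [lintegral_sub_right_eq_self (fun x => ENNReal.ofReal (heatKernel (t - p.1) x)) p.2]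
        exact lintegral_heatKernel_le _
    _ = _ := by simp

lemma measurable_testFn_mul_gKernel (η : TestFn d T) :
    Measurable fun r : SpaceTime d × SpaceTime d => η r.2 * gKernel r.2.1 r.2.2 r.1 :=
  (η.continuous.measurable.comp measurable_snd).mul
    (measurable_gKernel_prod.comp measurable_swap)

lemma integrable_testFn_mul_gKernel (η : TestFn d T) (p : SpaceTime d) :
    IntegrableOn (fun q => η q * gKernel q.1 q.2 p) (closedStrip d T) := by
  obtain ⟨C, -, hC⟩ := exists_bound_testFn η
  exact ⟨((measurable_testFn_mul_gKernel η).comp measurable_prodMk_left).aestronglyMeasurable,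
    (lintegral_testFn_mul_gKernel_le η hC p).trans_lt (ENNReal.mul_lt_top (by simp) (by simp))⟩

/-- `η * G̃` is a superposition of the functions `g_{tx}`. -/
lemma convReflected_eq (η : TestFn d T) (p : SpaceTime d) :
    convReflected η p = ∫ q in closedStrip d T, η q * gKernel q.1 q.2 p := by
  have h1 : ∀ q, q ∉ closedStrip d T → η q * gKernel q.1 q.2 p = 0 := fun q hq => by
    rw [testFn_eq_zero η hq, zero_mul]
  have hint : Integrable fun q => η q * gKernel q.1 q.2 p :=
    (integrableOn_iff_integrable_of_support_subset
      (Function.support_subset_iff'.2 h1)).1 (integrable_testFn_mul_gKernel η p)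
  rw [setIntegral_eq_integral_of_forall_compl_eq_zero h1, Measure.volume_eq_prod,
    integral_prod _ hint, convReflected,
    setIntegral_eq_integral_of_forall_compl_eq_zero fun r hr => by
      simp [heatKernel, show ¬ 0 < r from hr],
    ← integral_add_left_eq_self (fun t => ∫ x, η (t, x) * gKernel t x p) p.1]
  refine integral_congr_ae (ae_of_all _ fun r => ?_)
  simp only
  rw [← integral_add_left_eq_self (fun x => η (p.1 + r, x) * gKernel (p.1 + r) x p) p.2]
  simp [gKernel]

lemma stronglyMeasurable_convReflected (η : TestFn d T) :
    StronglyMeasurable (convReflected (d := d) η) := by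
  rw [funext (convReflected_eq η)]
  exact (measurable_testFn_mul_gKernel η).stronglyMeasurable.integral_prod_right'

lemma enorm_convReflected_le (η : TestFn d T) (p : SpaceTime d) :
    ‖convReflected η p‖ₑ ≤ ∫⁻ q in closedStrip d T, ‖η q * gKernel q.1 q.2 p‖ₑ := by
  rw [convReflected_eq]
  exact enorm_integral_le_lintegral_enorm _

lemma memAbsH_convReflected (hH : 1 / 2 < H) (η : TestFn d T) :
    MemAbsH H T (convReflected (d := d) η) := by
  obtain ⟨C, -, hC⟩ := exists_bound_testFn η
  have hm := (measurable_testFn_mul_gKernel η).enorm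
  refine memAbsH_of_bound hH (stronglyMeasurable_convReflected η).measurable
    (C := ENNReal.ofReal C * ENNReal.ofReal T) (M := ∫⁻ q, ‖η q‖ₑ)
    (ENNReal.mul_ne_top (by simp) (by simp)) (integrable_testFn η).2.ne
    (fun u _ x => (enorm_convReflected_le η _).trans (lintegral_testFn_mul_gKernel_le η hC _))
    fun u _ => ?_
  refine (lintegral_mono fun x => enorm_convReflected_le η (u, x)).trans ?_
  rw [lintegral_lintegral_swap (f := fun x q => ‖η q * gKernel q.1 q.2 (u, x)‖ₑ)
    (hm.comp (by fun_prop : Measurable fun r : EuclideanSpace ℝ (Fin d) × SpaceTime d =>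
      (((u, r.1), r.2) : SpaceTime d × SpaceTime d))).aemeasurable]
  refine (setLIntegral_le_lintegral _ _).trans (lintegral_mono fun q => ?_)
  simp only [enorm_mul, gKernel, enorm_heatKernel]
  rw [lintegral_const_mul' _ _ (by simp)]
  exact mul_le_of_le_one_right' (lintegral_heatKernel_sub_le _ _)

lemma innerH_eq_fracAdj (hH : 1 / 2 < H) (hH' : H < 1) (hψ : MemAbsH H T ψ)
    {φ : SpaceTime d → ℝ} (hφ : MemAbsH H T φ) :
    innerH H T ψ φ = H * (2 * H - 1) / (fracConst H).toReal *
      ∫ p in closedStrip d T, φ p * fracAdj H (frac H T ψ) p := by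
  have hc : (fracConst H).toReal ≠ 0 :=
    (ENNReal.toReal_pos (fracConst_ne_zero H) (fracConst_ne_top hH hH')).ne'
  rw [integral_mul_fracAdj hH hH' hφ (stronglyMeasurable_frac hψ.1).measurable
    (hψ.memLp_frac hH hH'), div_mul_eq_mul_div, eq_div_iff hc, mul_comm,
    integral_frac_mul hH hH' hψ hφ]

lemma ae_strip_mem (d : ℕ) (T : ℝ) :
    ∀ᵐ p : SpaceTime d ∂(volume.restrict (closedStrip d T)), p.1 ∈ Icc 0 T := by
  filter_upwards [ae_restrict_mem (measurableSet_closedStrip d T)] with p hp using hp.1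

/-- The `𝓗`-pairing commutes with the superposition `η * G̃ = ∫ η(p) g_p dp`. Fubini's theorem
applies because the energies of the `g_p` are bounded uniformly on the strip. -/
lemma innerH_convReflected (hH : 1 / 2 < H) (hH' : H < 1) (hd : (d : ℝ) / 4 < H)
    (hψ : MemAbsH H T ψ) (η : TestFn d T) :
    innerH H T ψ (convReflected (d := d) η) =
      ∫ q in closedStrip d T, η q * innerH H T ψ (gKernel q.1 q.2) := by
  set a := fracAdj H (frac H T ψ) with ha
  have hh := (stronglyMeasurable_frac (H := H) (T := T) hψ.1).measurable
  have h2 := hψ.memLp_frac hH hH'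
  have hma : Measurable a := (stronglyMeasurable_fracAdj hh).measurable
  have hmG := measurable_testFn_mul_gKernel η
  have hm : Measurable fun r : SpaceTime d × SpaceTime d =>
      η r.2 * gKernel r.2.1 r.2.2 r.1 * a r.1 := hmG.mul (hma.comp measurable_fst)
  have hint : Integrable (fun r : SpaceTime d × SpaceTime d =>
      η r.2 * gKernel r.2.1 r.2.2 r.1 * a r.1)
      ((volume.restrict (closedStrip d T)).prod (volume.restrict (closedStrip d T))) := by
    refine ⟨hm.aestronglyMeasurable, ?_⟩
    refine lt_of_eq_of_lt (lintegral_prod_symm' _ hm.enorm) ?_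
    set M : ℝ≥0∞ := (∫⁻ z, ‖frac H T ψ z‖ₑ ^ 2) + fracConst H * heatEnergy d H T with hM
    have hMt : M < ∞ := ENNReal.add_lt_top.2 ⟨lintegral_sq_lt_top h2,
      ENNReal.mul_lt_top (fracConst_ne_top hH hH').lt_top (heatEnergy_lt_top hH hd T)⟩
    refine lt_of_le_of_lt (lintegral_mono_ae (g := fun q => ‖η q‖ₑ * M) ?_) ?_
    · filter_upwards [ae_strip_mem d T] with q hq
      simp_rw [mul_assoc, enorm_mul (η q)]
      rw [lintegral_const_mul' _ _ (by simp)]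
      refine mul_le_mul' le_rfl ((lintegral_mul_fracAdj_le (measurable_gKernel q.1 q.2) hh).trans ?_)
      rw [energy_gKernel hq.2]
      exact add_le_add le_rfl (mul_le_mul' le_rfl (heatEnergy_mono hq.2))
    · rw [lintegral_mul_const _ (η.continuous.measurable.enorm)]
      exact ENNReal.mul_lt_top (integrable_testFn η).integrableOn.2 hMt
  rw [innerH_eq_fracAdj hH hH' hψ (memAbsH_convReflected hH η), ← ha]
  have h3 : ∀ p, convReflected η p * a p =
      ∫ q in closedStrip d T, η q * gKernel q.1 q.2 p * a p := fun p => by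
    rw [convReflected_eq, integral_mul_const]
  simp_rw [h3]
  rw [integral_integral_swap hint, ← integral_const_mul]
  refine integral_congr_ae ?_
  filter_upwards [ae_strip_mem d T] with q hq
  rw [innerH_eq_fracAdj hH hH' hψ (memAbsH_gKernel hH hd hq.2 q.2), ← ha]
  simp_rw [mul_assoc (η q)]
  rw [integral_const_mul]
  ring

end

/-! ### Smeared processes -/

section

variable {Ω : Type*} [MeasurableSpace Ω] {P : Measure Ω} [IsProbabilityMeasure P] {H T : ℝ}
  {F : TestFn d T → Ω → ℝ} {Y : ℝ → EuclideanSpace ℝ (Fin d) → Ω → ℝ}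

lemma measurable_smeared (hY : Measurable fun q : SpaceTime d × Ω => Y q.1.1 q.1.2 q.2)
    (η : TestFn d T) : Measurable fun r : Ω × SpaceTime d => Y r.2.1 r.2.2 r.1 * η r.2 :=
  (hY.comp measurable_swap).mul (η.continuous.measurable.comp measurable_snd)

/-- The second moment of a smeared process is controlled by its pointwise second moments and by the
`L¹` norm of the test function. The square is expanded as a double integral over the strip. -/
lemma lintegral_sq_smeared_le (hY : Measurable fun q : SpaceTime d × Ω => Y q.1.1 q.1.2 q.2)
    (η : TestFn d T) {C : ℝ≥0∞} (hC : ∀ p ∈ tsupport η, ∫⁻ ω, ‖Y p.1 p.2 ω‖ₑ ^ 2 ∂P ≤ C) :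
    ∫⁻ ω, (∫⁻ p in closedStrip d T, ‖Y p.1 p.2 ω * η p‖ₑ) ^ 2 ∂P ≤
      2 * C * (∫⁻ p, ‖η p‖ₑ) ^ 2 := by
  have hm := (measurable_smeared hY η).enorm
  have hYp : ∀ p : SpaceTime d, Measurable fun ω => ‖Y p.1 p.2 ω‖ₑ := fun p =>
    (hY.comp measurable_prodMk_left).enorm
  have hηm := η.continuous.measurable.enorm
  have hcross : ∀ p q : SpaceTime d,
      ∫⁻ ω, ‖Y p.1 p.2 ω * η p‖ₑ * ‖Y q.1 q.2 ω * η q‖ₑ ∂P ≤ 2 * C * (‖η p‖ₑ * ‖η q‖ₑ) := by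
    intro p q
    by_cases hp : p ∈ tsupport η
    · by_cases hq : q ∈ tsupport η
      · have h1 : ∀ ω, ‖Y p.1 p.2 ω * η p‖ₑ * ‖Y q.1 q.2 ω * η q‖ₑ =
            (‖Y p.1 p.2 ω‖ₑ * ‖Y q.1 q.2 ω‖ₑ) * (‖η p‖ₑ * ‖η q‖ₑ) := fun ω => by
          rw [enorm_mul, enorm_mul]; ring
        simp_rw [h1]
        rw [lintegral_mul_const (f := fun ω => ‖Y p.1 p.2 ω‖ₑ * ‖Y q.1 q.2 ω‖ₑ) _
          ((hYp p).mul (hYp q))]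
        refine mul_le_mul' ?_ le_rfl
        rw [two_mul]
        refine le_trans ?_ (add_le_add (hC p hp) (hC q hq))
        rw [← lintegral_add_left ((hYp p).pow_const 2)]
        refine lintegral_mono fun ω => ?_
        simp only [pow_two]
        rcases le_total ‖Y p.1 p.2 ω‖ₑ ‖Y q.1 q.2 ω‖ₑ with h | h
        · exact (mul_le_mul_left h _).trans le_add_self
        · exact (mul_le_mul_right h _).trans le_self_add
      · simp [image_eq_zero_of_notMem_tsupport hq]
    · simp [image_eq_zero_of_notMem_tsupport hp]
  have hm3 : Measurable fun r : (Ω × SpaceTime d) × SpaceTime d =>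
      ‖Y r.1.2.1 r.1.2.2 r.1.1 * η r.1.2‖ₑ * ‖Y r.2.1 r.2.2 r.1.1 * η r.2‖ₑ :=
    (hm.comp measurable_fst).mul (hm.comp (by fun_prop :
      Measurable fun r : (Ω × SpaceTime d) × SpaceTime d => (r.1.1, r.2)))
  calc ∫⁻ ω, (∫⁻ p in closedStrip d T, ‖Y p.1 p.2 ω * η p‖ₑ) ^ 2 ∂P
      = ∫⁻ ω, (∫⁻ p in closedStrip d T, ∫⁻ q in closedStrip d T,
          ‖Y p.1 p.2 ω * η p‖ₑ * ‖Y q.1 q.2 ω * η q‖ₑ) ∂P := by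
        refine lintegral_congr fun ω => ?_
        have := hm.comp (measurable_prodMk_left (x := ω))
        rw [pow_two]
        exact (lintegral_lintegral_mul this.aemeasurable this.aemeasurable).symm
    _ = ∫⁻ p in closedStrip d T, ∫⁻ ω, (∫⁻ q in closedStrip d T,
          ‖Y p.1 p.2 ω * η p‖ₑ * ‖Y q.1 q.2 ω * η q‖ₑ) ∂P :=
        lintegral_lintegral_swap
          (hm3.lintegral_prod_right' (ν := volume.restrict (closedStrip d T))).aemeasurable
    _ = ∫⁻ p in closedStrip d T, ∫⁻ q in closedStrip d T, ∫⁻ ω,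
          ‖Y p.1 p.2 ω * η p‖ₑ * ‖Y q.1 q.2 ω * η q‖ₑ ∂P := by
        refine lintegral_congr fun p => lintegral_lintegral_swap ?_
        exact (hm3.comp (by fun_prop : Measurable fun r : Ω × SpaceTime d =>
          (((r.1, p), r.2) : (Ω × SpaceTime d) × SpaceTime d))).aemeasurable
    _ ≤ ∫⁻ p, ∫⁻ q, 2 * C * (‖η p‖ₑ * ‖η q‖ₑ) :=
        (setLIntegral_le_lintegral _ _).trans <| lintegral_mono fun p =>
          (setLIntegral_le_lintegral _ _).trans <| lintegral_mono fun q => hcross p q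
    _ = 2 * C * (∫⁻ p, ‖η p‖ₑ) ^ 2 := by
        rw [pow_two, ← lintegral_lintegral_mul hηm.aemeasurable hηm.aemeasurable,
          ← lintegral_const_mul _ (Measurable.lintegral_prod_right'
            (f := fun r : SpaceTime d × SpaceTime d => ‖η r.1‖ₑ * ‖η r.2‖ₑ) (by fun_prop))]
        refine lintegral_congr fun p => ?_
        rw [lintegral_const_mul _ (by fun_prop)]

/-- A process is mean-square bounded on compact subsets of the closed strip. -/
def LocallyL2Bounded (T : ℝ) (P : Measure Ω) (Y : ℝ → EuclideanSpace ℝ (Fin d) → Ω → ℝ) : Prop :=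
  ∀ K : Set (SpaceTime d), IsCompact K → K ⊆ closedStrip d T →
    ∃ C : ℝ, ∀ p ∈ K, ∫⁻ ω, ‖Y p.1 p.2 ω‖ₑ ^ 2 ∂P ≤ ENNReal.ofReal C

lemma tsupport_subset_closedStrip (η : TestFn d T) : tsupport η ⊆ closedStrip d T :=
  fun _ h => ⟨Ioo_subset_Icc_self (η.tsupport_subset h).1, trivial⟩

lemma LocallyL2Bounded.lintegral_sq_lt_top (hb : LocallyL2Bounded T P Y)
    (hY : Measurable fun q : SpaceTime d × Ω => Y q.1.1 q.1.2 q.2) (η : TestFn d T) :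
    ∫⁻ ω, (∫⁻ p in closedStrip d T, ‖Y p.1 p.2 ω * η p‖ₑ) ^ 2 ∂P < ∞ := by
  obtain ⟨C, hC⟩ := hb _ η.hasCompactSupport.isCompact (tsupport_subset_closedStrip η)
  refine (lintegral_sq_smeared_le hY η hC).trans_lt ?_
  exact ENNReal.mul_lt_top (ENNReal.mul_lt_top (by simp) (by simp))
    (ENNReal.pow_lt_top (integrable_testFn η).2)

lemma LocallyL2Bounded.memLp_smeared (hb : LocallyL2Bounded T P Y)
    (hY : Measurable fun q : SpaceTime d × Ω => Y q.1.1 q.1.2 q.2) (η : TestFn d T) :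
    MemLp (fun ω => ∫ p in closedStrip d T, Y p.1 p.2 ω * η p) 2 P :=
  memLp_two_of_lintegral
    (measurable_smeared hY η).stronglyMeasurable.integral_prod_right'.aestronglyMeasurable
    ((lintegral_mono fun _ => pow_le_pow_left' (enorm_integral_le_lintegral_enorm _) 2).trans_lt
      (hb.lintegral_sq_lt_top hY η))

lemma LocallyL2Bounded.integral_mul_smeared (hb : LocallyL2Bounded T P Y)
    (hY : Measurable fun q : SpaceTime d × Ω => Y q.1.1 q.1.2 q.2) (η : TestFn d T)
    {W : Ω → ℝ} (hW : MemLp W 2 P) :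
    ∫ ω, W ω * (∫ p in closedStrip d T, Y p.1 p.2 ω * η p) ∂P =
      ∫ p in closedStrip d T, η p * ∫ ω, W ω * Y p.1 p.2 ω ∂P := by
  have hm := measurable_smeared hY η
  have hWm : AEStronglyMeasurable (fun r : Ω × SpaceTime d => W r.1)
      (P.prod (volume.restrict (closedStrip d T))) := hW.1.comp_fst
  have hint : Integrable (fun r : Ω × SpaceTime d => W r.1 * (Y r.2.1 r.2.2 r.1 * η r.2))
      (P.prod (volume.restrict (closedStrip d T))) := by
    refine ⟨hWm.mul hm.aestronglyMeasurable, ?_⟩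
    refine lt_of_eq_of_lt (lintegral_prod _ (hWm.mul hm.aestronglyMeasurable).enorm) ?_
    refine lt_of_le_of_lt (lintegral_mono (g := fun ω => ‖W ω‖ₑ ^ 2 +
      (∫⁻ p in closedStrip d T, ‖Y p.1 p.2 ω * η p‖ₑ) ^ 2) fun ω => ?_) ?_
    · simp only [enorm_mul (W _)]
      rw [lintegral_const_mul' _ _ (by simp), pow_two, pow_two]
      rcases le_total ‖W ω‖ₑ (∫⁻ p in closedStrip d T, ‖Y p.1 p.2 ω * η p‖ₑ) with h | h
      · exact (mul_le_mul_left h _).trans le_add_self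
      · exact (mul_le_mul_right h _).trans le_self_add
    · rw [lintegral_add_left' (hW.1.enorm.pow_const 2)]
      exact ENNReal.add_lt_top.2 ⟨FracHeat.lintegral_sq_lt_top hW, hb.lintegral_sq_lt_top hY η⟩
  have h1 : ∀ ω, W ω * (∫ p in closedStrip d T, Y p.1 p.2 ω * η p) =
      ∫ p in closedStrip d T, W ω * (Y p.1 p.2 ω * η p) := fun ω => (integral_const_mul _ _).symm
  simp_rw [h1]
  rw [integral_integral_swap hint]
  refine integral_congr_ae (ae_of_all _ fun p => ?_)
  simp only
  rw [← integral_const_mul]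
  refine integral_congr_ae (ae_of_all _ fun ω => by ring)

/-- A locally bounded jointly measurable modification of the process solution represents the
distribution-valued solution: the difference of both sides is a square-integrable variable that is
orthogonal to all stochastic integrals, hence to both sides. -/
lemma LocallyL2Bounded.distSolution_ae_eq (hF : IsFractionalWhiteNoise H T P F) (hH : 1 / 2 < H)
    (hH' : H < 1) (hd : (d : ℝ) / 4 < H) (hb : LocallyL2Bounded T P Y)
    (hY : Measurable fun q : SpaceTime d × Ω => Y q.1.1 q.1.2 q.2)
    (hYv : ∀ p ∈ closedStrip d T, Y p.1 p.2 =ᵐ[P] processSolution H T P F p.1 p.2)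
    (η : TestFn d T) :
    distSolution H T P F η =ᵐ[P] fun ω => ∫ p in closedStrip d T, Y p.1 p.2 ω * η p := by
  set I : Ω → ℝ := fun ω => ∫ p in closedStrip d T, Y p.1 p.2 ω * η p with hI
  have hImem : MemLp I 2 P := hb.memLp_smeared hY η
  have hV := isStochIntegral_stochIntegral hF hH hH' (memAbsH_convReflected (T := T) hH η)
  change IsStochIntegral H T P F _ (distSolution H T P F η) at hV
  set V := distSolution H T P F η with hVdef
  have hg : ∀ p ∈ closedStrip d T,
      IsStochIntegral H T P F (gKernel p.1 p.2) (processSolution H T P F p.1 p.2) := fun p hp =>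
    isStochIntegral_stochIntegral hF hH hH' (memAbsH_gKernel hH hd hp.1.2 p.2)
  have hW : MemLp (V - I) 2 P := hV.memLp.sub hImem
  -- The covariances of `V` and of `I` with any stochastic integral agree.
  have horth : ∀ ψ X, IsStochIntegral H T P F ψ X → ∫ ω, (V - I) ω * X ω ∂P = 0 := by
    intro ψ X hX
    have h1 : ∫ ω, X ω * I ω ∂P = ∫ ω, X ω * V ω ∂P := by
      rw [hX.integral_mul hF hH hH' hV, innerH_convReflected hH hH' hd hX.mem_absH,
        hb.integral_mul_smeared hY η hX.memLp]
      refine integral_congr_ae ?_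
      filter_upwards [ae_restrict_mem (measurableSet_closedStrip d T)] with p hp
      rw [← hX.integral_mul hF hH hH' (hg p hp)]
      congr 1
      refine integral_congr_ae ?_
      filter_upwards [hYv p hp] with ω hω
      rw [hω]
    have h2 : ∀ ω, (V - I) ω * X ω = X ω * V ω - X ω * I ω := fun ω => by
      rw [Pi.sub_apply]; ring
    simp_rw [h2]
    rw [integral_sub (f := fun ω => X ω * V ω) (g := fun ω => X ω * I ω)
      (hX.memLp.integrable_mul hV.memLp) (hX.memLp.integrable_mul hImem), h1,
      sub_self]
  -- Both `V` and `I`, a superposition of stochastic integrals, are orthogonal to `V - I`.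
  have h0 : ∫ ω, (V - I) ω * (V - I) ω ∂P = 0 := by
    have h3 : ∫ ω, (V - I) ω * I ω ∂P = 0 := by
      rw [hb.integral_mul_smeared hY η hW]
      refine integral_eq_zero_of_ae ?_
      filter_upwards [ae_restrict_mem (measurableSet_closedStrip d T)] with p hp
      rw [Pi.zero_apply, ← mul_zero (η p), ← horth _ _ (hg p hp)]
      congr 1
      refine integral_congr_ae ?_
      filter_upwards [hYv p hp] with ω hω
      rw [hω]
    have h4 : ∀ ω, (V - I) ω * (V - I) ω = (V - I) ω * V ω - (V - I) ω * I ω := fun ω => by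
      rw [← mul_sub, ← Pi.sub_apply]
    simp_rw [h4]
    rw [integral_sub (f := fun ω => (V - I) ω * V ω) (g := fun ω => (V - I) ω * I ω)
      (hW.integrable_mul hV.memLp) (hW.integrable_mul hImem), h3,
      horth _ _ hV, sub_self]
  have h5 := (integral_eq_zero_iff_of_nonneg (fun ω => mul_self_nonneg ((V - I) ω))
    (hW.integrable_mul hW)).1 h0
  filter_upwards [h5] with ω hω
  have := mul_self_eq_zero.1 hω
  exact sub_eq_zero.1 this

end

/-! ### The process solution above the critical Hurst index -/

section

variable {Ω : Type*} [MeasurableSpace Ω] {P : Measure Ω} {H T : ℝ}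
  {F : TestFn d T → Ω → ℝ} {Y : ℝ → EuclideanSpace ℝ (Fin d) → Ω → ℝ} {φ ψ : SpaceTime d → ℝ}
  {X Z : Ω → ℝ}

lemma frac_eq_toReal_lfrac (hφ : Measurable φ) (h0 : ∀ p, 0 ≤ φ p) (z : SpaceTime d) :
    frac H T φ z = (lfrac H T (fun p => ‖φ p‖ₑ) z).toReal := by
  rw [frac, integral_eq_lintegral_of_nonneg_ae
    (ae_of_all _ fun u => mul_nonneg (h0 _) (fracKernel_nonneg _ _ _))
    ((measurable_frac_integrand (H := H) hφ).comp measurable_prodMk_left).aestronglyMeasurable,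
    lfrac]
  congr 1
  refine lintegral_congr fun u => ?_
  rw [ENNReal.ofReal_mul (h0 _), ← ofReal_norm, Real.norm_of_nonneg (h0 _)]

lemma innerH_self_of_nonneg (hH : 1 / 2 < H) (hH' : H < 1) (hφ : MemAbsH H T φ)
    (h0 : ∀ p, 0 ≤ φ p) :
    innerH H T φ φ =
      H * (2 * H - 1) * (energy H T (fun p => ‖φ p‖ₑ) (fun p => ‖φ p‖ₑ)).toReal := by
  have hc : (fracConst H).toReal ≠ 0 :=
    (ENNReal.toReal_pos (fracConst_ne_zero H) (fracConst_ne_top hH hH')).ne'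
  have ml := measurable_lfrac H T hφ.1.enorm
  rw [← mul_right_inj' hc, ← integral_frac_mul hH hH' hφ hφ, mul_left_comm, ← ENNReal.toReal_mul,
    ← lintegral_lfrac_mul H T hφ.1.enorm hφ.1.enorm]
  congr 1
  rw [← integral_toReal (f := fun z => lfrac H T (fun p => ‖φ p‖ₑ) z *
    lfrac H T (fun p => ‖φ p‖ₑ) z) (ml.mul ml).aemeasurable]
  · refine integral_congr_ae (ae_of_all _ fun z => ?_)
    simp only [frac_eq_toReal_lfrac hφ.1 h0, ENNReal.toReal_mul]
  · exact ae_lt_top (ml.mul ml) (hφ.lintegral_lfrac_sq_lt_top hH hH').ne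

lemma lintegral_enorm_sq (hX : MemLp X 2 P) :
    ∫⁻ ω, ‖X ω‖ₑ ^ 2 ∂P = ENNReal.ofReal (∫ ω, X ω * X ω ∂P) := by
  rw [ofReal_integral_eq_lintegral_ofReal (f := fun ω => X ω * X ω) (hX.integrable_mul hX)
    (ae_of_all _ fun ω => mul_self_nonneg _)]
  refine lintegral_congr fun ω => ?_
  rw [pow_two, ← enorm_mul, ← ofReal_norm, Real.norm_of_nonneg (mul_self_nonneg _)]

lemma gKernel_nonneg (t : ℝ) (x : EuclideanSpace ℝ (Fin d)) (p : SpaceTime d) :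
    0 ≤ gKernel t x p := heatKernel_nonneg _ _

lemma isStochIntegral_processSolution (hF : IsFractionalWhiteNoise H T P F) (hH : 1 / 2 < H)
    (hH' : H < 1) (hd : (d : ℝ) / 4 < H) {t : ℝ} (ht : t ≤ T) (x : EuclideanSpace ℝ (Fin d)) :
    IsStochIntegral H T P F (gKernel t x) (processSolution H T P F t x) :=
  isStochIntegral_stochIntegral hF hH hH' (memAbsH_gKernel hH hd ht x)

lemma lintegral_processSolution_sq_le (hF : IsFractionalWhiteNoise H T P F) (hH : 1 / 2 < H)
    (hH' : H < 1) (hd : (d : ℝ) / 4 < H) {t : ℝ} (ht : t ≤ T) (x : EuclideanSpace ℝ (Fin d)) :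
    ∫⁻ ω, ‖processSolution H T P F t x ω‖ₑ ^ 2 ∂P ≤
      ENNReal.ofReal (H * (2 * H - 1) * (heatEnergy d H T).toReal) := by
  have h := isStochIntegral_processSolution hF hH hH' hd ht x
  rw [lintegral_enorm_sq h.memLp, h.integral_mul hF hH hH' h,
    innerH_self_of_nonneg hH hH' h.mem_absH (gKernel_nonneg t x), energy_gKernel ht]
  refine ENNReal.ofReal_le_ofReal (mul_le_mul_of_nonneg_left ?_ ?_)
  · exact ENNReal.toReal_mono (heatEnergy_lt_top hH hd T).ne (heatEnergy_mono ht)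
  · exact mul_nonneg (by linarith) (by linarith)

lemma inner_fracL2 (hH : 1 / 2 < H) (hH' : H < 1) (hφ : MemAbsH H T φ)
    (hψ : MemAbsH H T ψ) :
    inner ℝ (fracL2 H T φ) (fracL2 H T ψ) = ∫ z, frac H T φ z * frac H T ψ z := by
  rw [L2.inner_def]
  refine integral_congr_ae ?_
  filter_upwards [hφ.coeFn_fracL2 hH hH', hψ.coeFn_fracL2 hH hH'] with z h1 h2
  rw [h1, h2]
  simp [mul_comm]

/-- The isometry between `L²(Ω)`-distances of stochastic integrals and `L²`-distances of the
fractional integrals of the integrands. -/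
lemma IsStochIntegral.eLpNorm_sub (hF : IsFractionalWhiteNoise H T P F) (hH : 1 / 2 < H)
    (hH' : H < 1) (hX : IsStochIntegral H T P F φ X) (hZ : IsStochIntegral H T P F ψ Z) :
    eLpNorm (X - Z) 2 P = ENNReal.ofReal (√(H * (2 * H - 1) / (fracConst H).toReal) *
      dist (fracL2 H T φ) (fracL2 H T ψ)) := by
  have hc := innerH_const_pos hH hH'
  have h1 : ‖hX.memLp.toLp X - hZ.memLp.toLp Z‖ ^ 2 =
      H * (2 * H - 1) / (fracConst H).toReal * ‖fracL2 H T φ - fracL2 H T ψ‖ ^ 2 := by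
    rw [norm_sub_sq_real, norm_sub_sq_real, ← real_inner_self_eq_norm_sq,
      ← real_inner_self_eq_norm_sq, ← real_inner_self_eq_norm_sq, ← real_inner_self_eq_norm_sq,
      inner_toLp, inner_toLp, inner_toLp, hX.integral_mul hF hH hH' hX,
      hX.integral_mul hF hH hH' hZ, hZ.integral_mul hF hH hH' hZ,
      innerH_eq_inner hH hH' hX.mem_absH hX.mem_absH,
      innerH_eq_inner hH hH' hX.mem_absH hZ.mem_absH,
      innerH_eq_inner hH hH' hZ.mem_absH hZ.mem_absH]
    ring
  rw [dist_eq_norm, ← Real.sqrt_sq (norm_nonneg (fracL2 H T φ - _)), ← Real.sqrt_mul hc.le, ← h1,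
    Real.sqrt_sq (norm_nonneg _), ← MemLp.toLp_sub, Lp.norm_toLp,
    ENNReal.ofReal_toReal (hX.memLp.sub hZ.memLp).2.ne]

/-- Above the critical index the process solution has a jointly measurable modification. The time
variable is capped at `T` so that the process is defined on the whole space-time. -/
lemma exists_modification [IsProbabilityMeasure P] (hF : IsFractionalWhiteNoise H T P F)
    (hH : 1 / 2 < H) (hH' : H < 1) (hd : (d : ℝ) / 4 < H) :
    ∃ Y : ℝ → EuclideanSpace ℝ (Fin d) → Ω → ℝ,
      (Measurable fun q : SpaceTime d × Ω => Y q.1.1 q.1.2 q.2) ∧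
      ∀ p ∈ closedStrip d T, Y p.1 p.2 =ᵐ[P] processSolution H T P F p.1 p.2 := by
  let cl : ℝ → ℝ := fun t => min t T
  have hcl : ∀ t, cl t ≤ T := fun t => min_le_right _ _
  have hclm : Measurable cl := measurable_id.min measurable_const
  let e : SpaceTime d → Lp ℝ 2 (volume : Measure (SpaceTime d)) := fun p =>
    fracL2 H T (gKernel (cl p.1) p.2)
  have hmem : ∀ p : SpaceTime d, MemAbsH H T (gKernel (cl p.1) p.2) := fun p =>
    memAbsH_gKernel hH hd (hcl p.1) p.2
  have hfm : StronglyMeasurable fun r : SpaceTime d × SpaceTime d =>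
      frac H T (gKernel (cl r.1.1) r.1.2) r.2 := by
    unfold frac
    have h1 : Measurable fun r : (SpaceTime d × SpaceTime d) × ℝ =>
        gKernel (cl r.1.1.1) r.1.1.2 (r.2, r.1.2.2) :=
      measurable_gKernel_prod.comp (by fun_prop :
        Measurable fun r : (SpaceTime d × SpaceTime d) × ℝ =>
          (((cl r.1.1.1, r.1.1.2), (r.2, r.1.2.2)) : SpaceTime d × SpaceTime d))
    have h2 : Measurable fun r : (SpaceTime d × SpaceTime d) × ℝ =>
        fracKernel H r.2 r.1.2.1 :=
      (measurable_fracKernel H).comp (by fun_prop :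
        Measurable fun r : (SpaceTime d × SpaceTime d) × ℝ => ((r.2, r.1.2.1) : ℝ × ℝ))
    exact (h1.mul h2).stronglyMeasurable.integral_prod_right'
  have he : ∀ q, Measurable fun p => dist (e p) (e q) := by
    intro q
    have h1 : ∀ p, dist (e p) (e q) = √((∫ z, frac H T (gKernel (cl p.1) p.2) z *
        frac H T (gKernel (cl p.1) p.2) z) - 2 * (∫ z, frac H T (gKernel (cl p.1) p.2) z *
        frac H T (gKernel (cl q.1) q.2) z) + ‖e q‖ ^ 2) := by
      intro p
      rw [dist_eq_norm, ← Real.sqrt_sq (norm_nonneg (e p - e q)), norm_sub_sq_real,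
        ← inner_fracL2 hH hH' (hmem p) (hmem p), ← inner_fracL2 hH hH' (hmem p) (hmem q),
        real_inner_self_eq_norm_sq]
    simp_rw [h1]
    have m1 := (hfm.mul hfm).integral_prod_right' (ν := volume)
    have m2 := (hfm.mul ((stronglyMeasurable_frac (H := H) (T := T) (hmem q).1).comp_measurable
      measurable_snd)).integral_prod_right' (ν := volume)
    exact (((m1.measurable).sub (m2.measurable.const_mul 2)).add_const _).sqrt
  have : Fact ((2 : ℝ≥0∞) ≠ ∞) := ⟨by simp⟩
  obtain ⟨Y, hY, hYZ⟩ := exists_measurable_modification e he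
    (fun p => processSolution H T P F (cl p.1) p.2)
    (fun p => (isStochIntegral_processSolution hF hH hH' hd (hcl p.1) p.2).memLp.1)
    _ (Real.sqrt_nonneg _)
    fun p q => (IsStochIntegral.eLpNorm_sub hF hH hH'
      (isStochIntegral_processSolution hF hH hH' hd (hcl p.1) p.2)
      (isStochIntegral_processSolution hF hH hH' hd (hcl q.1) q.2)).le
  refine ⟨fun t x => Y (t, x), hY, fun p hp => ?_⟩
  have := hYZ p
  simp only [cl, min_eq_left hp.1.2] at this
  exact this

lemma representsSolution_of_modification [IsProbabilityMeasure P]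
    (hF : IsFractionalWhiteNoise H T P F)
    (hH : 1 / 2 < H) (hH' : H < 1) (hd : (d : ℝ) / 4 < H)
    (hY : Measurable fun q : SpaceTime d × Ω => Y q.1.1 q.1.2 q.2)
    (hYv : ∀ p ∈ closedStrip d T, Y p.1 p.2 =ᵐ[P] processSolution H T P F p.1 p.2) :
    RepresentsSolution H T P F Y := by
  have hb : LocallyL2Bounded T P Y := by
    intro K _ hK
    refine ⟨H * (2 * H - 1) * (heatEnergy d H T).toReal, fun p hp => ?_⟩
    rw [lintegral_congr_ae (g := fun ω => ‖processSolution H T P F p.1 p.2 ω‖ₑ ^ 2)]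
    · exact lintegral_processSolution_sq_le hF hH hH' hd (hK hp).1.2 p.2
    · filter_upwards [hYv p (hK hp)] with ω hω
      rw [hω]
  exact ⟨hY, hb, hb.distSolution_ae_eq hF hH hH' hd hY hYv⟩

end

/-! ### Uniqueness of the representing process -/

section

variable {Ω : Type*} [MeasurableSpace Ω] {P : Measure Ω} [IsProbabilityMeasure P] {H T : ℝ}
  {F : TestFn d T → Ω → ℝ} {Y Y' : ℝ → EuclideanSpace ℝ (Fin d) → Ω → ℝ}

/-- A function whose integrals over measurable rectangles vanish is zero almost everywhere, since the
rectangles form a π-system that generates the product σ-algebra. -/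
lemma ae_zero_of_setIntegral_prod_eq_zero {S : Type*} [MeasurableSpace S] {μ : Measure S}
    [IsFiniteMeasure μ] {f : S × Ω → ℝ} (hf : Integrable f (μ.prod P))
    (h : ∀ B A, MeasurableSet B → MeasurableSet A → ∫ r in B ×ˢ A, f r ∂(μ.prod P) = 0) :
    f =ᵐ[μ.prod P] 0 := by
  refine hf.ae_eq_zero_of_forall_setIntegral_eq_zero fun s hs _ => ?_
  induction s, hs using MeasurableSpace.induction_on_inter generateFrom_prod.symm isPiSystem_prod with
  | empty => simp
  | basic t ht =>
    obtain ⟨B, hB, A, hA, rfl⟩ := ht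
    exact h B A hB hA
  | compl t ht ih =>
    have h1 := integral_add_compl ht hf
    have h2 := h univ univ MeasurableSet.univ MeasurableSet.univ
    rw [univ_prod_univ, setIntegral_univ] at h2
    rw [ih (measure_lt_top _ _), h2, zero_add] at h1
    exact h1
  | iUnion g hd hm ih =>
    rw [integral_iUnion hm hd hf.integrableOn]
    simp [fun i => ih i (measure_lt_top _ _)]

end

section

variable {Ω : Type*} [MeasurableSpace Ω] {P : Measure Ω} {H T : ℝ}
  {F : TestFn d T → Ω → ℝ} {Y Y' : ℝ → EuclideanSpace ℝ (Fin d) → Ω → ℝ}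

lemma LocallyL2Bounded.sub (hb : LocallyL2Bounded T P Y) (hb' : LocallyL2Bounded T P Y')
    (hY : Measurable fun q : SpaceTime d × Ω => Y q.1.1 q.1.2 q.2) :
    LocallyL2Bounded T P fun t x ω => Y t x ω - Y' t x ω := by
  intro K hK hKT
  obtain ⟨C, hC⟩ := hb K hK hKT
  obtain ⟨C', hC'⟩ := hb' K hK hKT
  refine ⟨4 * max C 0 + 4 * max C' 0, fun p hp => ?_⟩
  have hm : Measurable fun ω => ‖Y p.1 p.2 ω‖ₑ := (hY.comp measurable_prodMk_left).enorm
  refine (lintegral_mono (g := fun ω => 4 * ‖Y p.1 p.2 ω‖ₑ ^ 2 + 4 * ‖Y' p.1 p.2 ω‖ₑ ^ 2)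
    fun ω => ?_).trans ?_
  · refine (pow_le_pow_left' enorm_sub_le 2).trans ?_
    change _ ≤ 4 * ‖Y p.1 p.2 ω‖ₑ ^ 2 + 4 * ‖Y' p.1 p.2 ω‖ₑ ^ 2
    generalize ‖Y p.1 p.2 ω‖ₑ = a
    generalize ‖Y' p.1 p.2 ω‖ₑ = b
    rcases le_total a b with h | h
    · calc (a + b) ^ 2 ≤ (b + b) ^ 2 := by gcongr
        _ = 4 * b ^ 2 := by ring
        _ ≤ 4 * a ^ 2 + 4 * b ^ 2 := le_add_self
    · calc (a + b) ^ 2 ≤ (a + a) ^ 2 := by gcongr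
        _ = 4 * a ^ 2 := by ring
        _ ≤ 4 * a ^ 2 + 4 * b ^ 2 := le_self_add
  · rw [lintegral_add_left ((hm.pow_const 2).const_mul 4), lintegral_const_mul' _ _ (by simp),
      lintegral_const_mul' _ _ (by simp), ENNReal.ofReal_add (by positivity) (by positivity),
      ENNReal.ofReal_mul zero_le_four, ENNReal.ofReal_mul zero_le_four, ENNReal.ofReal_ofNat]
    gcongr
    · exact (hC p hp).trans (ENNReal.ofReal_le_ofReal (le_max_left _ _))
    · exact (hC' p hp).trans (ENNReal.ofReal_le_ofReal (le_max_left _ _))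

variable [IsProbabilityMeasure P]

lemma LocallyL2Bounded.ae_integrableOn_smeared (hb : LocallyL2Bounded T P Y)
    (hY : Measurable fun q : SpaceTime d × Ω => Y q.1.1 q.1.2 q.2) (η : TestFn d T) :
    ∀ᵐ ω ∂P, IntegrableOn (fun p : SpaceTime d => Y p.1 p.2 ω * η p) (closedStrip d T) := by
  have hm := measurable_smeared hY η
  filter_upwards [ae_lt_top ((hm.enorm.lintegral_prod_right'
    (ν := volume.restrict (closedStrip d T))).pow_const 2) (hb.lintegral_sq_lt_top hY η).ne]
    with ω hω
  refine ⟨(hm.comp measurable_prodMk_left).aestronglyMeasurable, ?_⟩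
  rw [HasFiniteIntegral, lt_top_iff_ne_top]
  intro h
  have h2 : (∫⁻ p in closedStrip d T, ‖Y p.1 p.2 ω * η p‖ₑ) ^ 2 < ∞ := hω
  simp only [h] at h2
  simp at h2

lemma LocallyL2Bounded.integrable_prod (hb : LocallyL2Bounded T P Y)
    (hY : Measurable fun q : SpaceTime d × Ω => Y q.1.1 q.1.2 q.2) {K : Set (SpaceTime d)}
    (hK : IsCompact K) (hKT : K ⊆ closedStrip d T) :
    Integrable (fun r : SpaceTime d × Ω => Y r.1.1 r.1.2 r.2) ((volume.restrict K).prod P) := by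
  obtain ⟨C, hC⟩ := hb K hK hKT
  refine ⟨hY.aestronglyMeasurable, ?_⟩
  refine lt_of_eq_of_lt (lintegral_prod _ hY.enorm.aemeasurable) ?_
  calc ∫⁻ p in K, ∫⁻ ω, ‖Y p.1 p.2 ω‖ₑ ∂P
      ≤ ∫⁻ p in K, (1 + ENNReal.ofReal C) := by
        refine setLIntegral_mono' hK.measurableSet fun p hp => ?_
        refine le_trans (lintegral_mono (g := fun ω => 1 + ‖Y p.1 p.2 ω‖ₑ ^ 2) fun ω => ?_) ?_
        · rcases le_total ‖Y p.1 p.2 ω‖ₑ 1 with h | h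
          · exact h.trans le_self_add
          · refine le_trans ?_ le_add_self
            rw [pow_two]
            exact le_mul_of_one_le_left' h
        · rw [lintegral_add_left measurable_const]
          simpa using add_le_add_right (hC p hp) 1
    _ < ∞ := by
        rw [setLIntegral_const]
        exact ENNReal.mul_lt_top (by simp) hK.measure_lt_top

/-- A process whose smearings against all test functions vanish is itself zero, almost surely at
almost every point: its integral vanishes over all measurable rectangles. -/
lemma LocallyL2Bounded.ae_eq_zero (hb : LocallyL2Bounded T P Y)
    (hY : Measurable fun q : SpaceTime d × Ω => Y q.1.1 q.1.2 q.2)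
    (h0 : ∀ η : TestFn d T, ∀ᵐ ω ∂P, ∫ p in closedStrip d T, Y p.1 p.2 ω * η p = 0) :
    ∀ᵐ p : SpaceTime d ∂(volume.restrict (closedStrip d T)), Y p.1 p.2 =ᵐ[P] 0 := by
  have hopen := isOpen_openStrip d T
  have hsec : ∀ (A : Set Ω), MeasurableSet A → ∀ K : Set (SpaceTime d), IsCompact K →
      K ⊆ closedStrip d T → IntegrableOn (fun p => ∫ ω in A, Y p.1 p.2 ω ∂P) K := by
    intro A hA K hK hKT
    have h1 := (hb.integrable_prod hY hK hKT).integrableOn (s := univ ×ˢ A)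
    rw [IntegrableOn, ← Measure.prod_restrict, Measure.restrict_univ] at h1
    exact h1.integral_prod_left
  have hA0 : ∀ A : Set Ω, MeasurableSet A →
      ∀ᵐ p : SpaceTime d ∂(volume.restrict (closedStrip d T)), ∫ ω in A, Y p.1 p.2 ω ∂P = 0 := by
    intro A hA
    rw [← volume_restrict_openStrip, ae_restrict_iff' hopen.measurableSet]
    refine hopen.ae_eq_zero_of_integral_contDiff_smul_eq_zero ?_ ?_
    · refine (locallyIntegrableOn_iff hopen.isLocallyClosed).2 fun K hKU hK => ?_
      exact hsec A hA K hK (hKU.trans (prod_mono_left Ioo_subset_Icc_self))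
    · intro g hg hgc hgs
      let η : TestFn d T := ⟨g, hg, hgc, hgs⟩
      have hW : MemLp (A.indicator fun _ => (1 : ℝ)) 2 P :=
        (memLp_const 1).indicator hA
      have h1 := hb.integral_mul_smeared hY η hW
      have h2 : ∫ ω, A.indicator (fun _ => (1 : ℝ)) ω *
          (∫ p in closedStrip d T, Y p.1 p.2 ω * η p) ∂P = 0 := by
        refine integral_eq_zero_of_ae ?_
        filter_upwards [h0 η] with ω hω
        simp [hω]
      have h3 : ∀ p : SpaceTime d, ∫ ω, A.indicator (fun _ => (1 : ℝ)) ω * Y p.1 p.2 ω ∂P =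
          ∫ ω in A, Y p.1 p.2 ω ∂P := by
        intro p
        rw [← integral_indicator hA]
        refine integral_congr_ae (ae_of_all _ fun ω => ?_)
        by_cases h : ω ∈ A <;> simp [h]
      rw [h2] at h1
      simp_rw [h3] at h1
      rw [h1]
      refine (setIntegral_eq_integral_of_forall_compl_eq_zero fun p hp => ?_).symm
      have : g p = 0 := testFn_eq_zero η hp
      simp [this]
  have hcl : IsClosed (closedStrip d T) := isClosed_Icc.prod isClosed_univ
  have hKN : ∀ N : ℕ, ∀ᵐ p : SpaceTime d
      ∂(volume.restrict (closedStrip d T ∩ Metric.closedBall 0 N)), Y p.1 p.2 =ᵐ[P] 0 := by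
    intro N
    have hK : IsCompact (closedStrip d T ∩ Metric.closedBall 0 N) :=
      (isCompact_closedBall 0 (N : ℝ)).inter_left hcl
    have : IsFiniteMeasure ((volume : Measure (SpaceTime d)).restrict
        (closedStrip d T ∩ Metric.closedBall 0 N)) := ⟨by simpa using hK.measure_lt_top⟩
    have hint := hb.integrable_prod hY hK inter_subset_left
    refine Measure.ae_ae_of_ae_prod (ae_zero_of_setIntegral_prod_eq_zero hint ?_)
    intro B A hB hA
    rw [setIntegral_prod _ hint.integrableOn]
    refine integral_eq_zero_of_ae ?_
    exact ae_restrict_of_ae (ae_mono (Measure.restrict_mono inter_subset_left le_rfl) (hA0 A hA))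
  have hU : closedStrip d T = ⋃ N : ℕ, closedStrip d T ∩ Metric.closedBall 0 N := by
    rw [← inter_iUnion, Metric.iUnion_closedBall_nat, inter_univ]
  rw [hU, ae_restrict_iUnion_iff]
  exact hKN

lemma RepresentsSolution.ae_eq (h : RepresentsSolution H T P F Y)
    (h' : RepresentsSolution H T P F Y') :
    ∀ᵐ p : SpaceTime d ∂(volume.restrict (closedStrip d T)), Y p.1 p.2 =ᵐ[P] Y' p.1 p.2 := by
  have hb : LocallyL2Bounded T P Y := h.locally_bounded
  have hb' : LocallyL2Bounded T P Y' := h'.locally_bounded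
  have key := (hb.sub hb' h.jointly_measurable).ae_eq_zero
    (h.jointly_measurable.sub h'.jointly_measurable) fun η => by
      filter_upwards [h.represents η, h'.represents η,
        hb.ae_integrableOn_smeared h.jointly_measurable η,
        hb'.ae_integrableOn_smeared h'.jointly_measurable η] with ω h1 h2 h3 h4
      simp_rw [sub_mul]
      rw [integral_sub h3 h4, ← h1, ← h2, sub_self]
  filter_upwards [key] with p hp
  filter_upwards [hp] with ω hω
  exact sub_eq_zero.1 hω

end

/-! ### Necessity of the condition on the Hurst index -/

section

variable {Ω : Type*} [MeasurableSpace Ω] {P : Measure Ω} [IsProbabilityMeasure P] {H T : ℝ}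
  {F : TestFn d T → Ω → ℝ} {Y : ℝ → EuclideanSpace ℝ (Fin d) → Ω → ℝ}

/-- Fatou's lemma for the energy. -/
lemma energy_le_of_tendsto (hH : 1 / 2 < H) (hH' : H < 1) {f : SpaceTime d → ℝ≥0∞}
    {fn : ℕ → SpaceTime d → ℝ≥0∞} (hf : Measurable f) (hfn : ∀ n, Measurable (fn n))
    {t₀ : ℝ} (hlim : ∀ p : SpaceTime d, t₀ ≠ p.1 → Tendsto (fun n => fn n p) atTop (𝓝 (f p)))
    {M : ℝ≥0∞} (hM : ∀ n, energy H T (fn n) (fn n) ≤ M) : energy H T f f ≤ M := by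
  have hk : ∀ z : SpaceTime d, Measurable fun u => ENNReal.ofReal (fracKernel H u z.1) := fun z =>
    ((measurable_fracKernel H).comp (measurable_id.prodMk measurable_const)).ennreal_ofReal
  have h1 : ∀ z, lfrac H T f z ≤ liminf (fun n => lfrac H T (fn n) z) atTop := by
    intro z
    refine le_trans (le_of_eq ?_) (lintegral_liminf_le fun n =>
      ((hfn n).comp measurable_prodMk_right).mul (hk z))
    refine lintegral_congr_ae ?_
    filter_upwards [ae_fst_ne t₀] with u hu
    exact (ENNReal.Tendsto.mul_const (hlim (u, z.2) hu) (Or.inr (by simp))).liminf_eq.symm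
  rw [← ENNReal.mul_le_mul_iff_right (fracConst_ne_zero H) (fracConst_ne_top hH hH'),
    ← lintegral_lfrac_mul H T hf hf]
  have hm := fun n => measurable_lfrac H T (hfn n)
  calc ∫⁻ z, lfrac H T f z * lfrac H T f z
      ≤ ∫⁻ z, liminf (fun n => lfrac H T (fn n) z * lfrac H T (fn n) z) atTop :=
        lintegral_mono fun z => (mul_le_mul' (h1 z) (h1 z)).trans ENNReal.le_liminf_mul
    _ ≤ liminf (fun n => ∫⁻ z, lfrac H T (fn n) z * lfrac H T (fn n) z) atTop :=
        lintegral_liminf_le fun n => (hm n).mul (hm n)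
    _ ≤ fracConst H * M := by
        refine liminf_le_of_frequently_le' (Frequently.of_forall fun n => ?_)
        rw [lintegral_lfrac_mul H T (hfn n) (hfn n)]
        exact mul_le_mul' le_rfl (hM n)

/-- The representing process controls the energy of `η * G̃` by the `L¹` norm of `η`. -/
lemma RepresentsSolution.energy_convReflected_le (h : RepresentsSolution H T P F Y)
    (hF : IsFractionalWhiteNoise H T P F) (hH : 1 / 2 < H) (hH' : H < 1) {η : TestFn d T}
    (hη : ∀ p, 0 ≤ η p) {C : ℝ≥0∞}
    (hC : ∀ p ∈ tsupport η, ∫⁻ ω, ‖Y p.1 p.2 ω‖ₑ ^ 2 ∂P ≤ C) :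
    ENNReal.ofReal (H * (2 * H - 1)) *
      energy H T (fun p => ‖convReflected η p‖ₑ) (fun p => ‖convReflected η p‖ₑ) ≤
      2 * C * (∫⁻ p, ‖η p‖ₑ) ^ 2 := by
  have hV := isStochIntegral_stochIntegral hF hH hH' (memAbsH_convReflected (T := T) hH η)
  have h0 : ∀ p : SpaceTime d, 0 ≤ convReflected η p := fun p => by
    rw [convReflected_eq]
    exact integral_nonneg fun q => mul_nonneg (hη q) (gKernel_nonneg _ _ _)
  have h1 : ∫⁻ ω, ‖distSolution H T P F η ω‖ₑ ^ 2 ∂P = ENNReal.ofReal (H * (2 * H - 1)) *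
      energy H T (fun p => ‖convReflected η p‖ₑ) (fun p => ‖convReflected η p‖ₑ) := by
    rw [distSolution, lintegral_enorm_sq hV.memLp, hV.integral_mul hF hH hH' hV,
      innerH_self_of_nonneg hH hH' hV.mem_absH h0,
      ENNReal.ofReal_mul (mul_nonneg (by linarith) (by linarith)),
      ENNReal.ofReal_toReal (memAbsH_iff.1 hV.mem_absH).2.ne]
  rw [← h1]
  refine le_trans (le_trans (lintegral_mono_ae ?_) le_rfl)
    (lintegral_sq_smeared_le h.jointly_measurable η hC)
  filter_upwards [h.represents η] with ω hω
  rw [hω]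
  exact pow_le_pow_left' (enorm_integral_le_lintegral_enorm _) 2

lemma continuousAt_heatKernel {t : ℝ} (ht : t ≠ 0) (x : EuclideanSpace ℝ (Fin d)) :
    ContinuousAt (fun q : SpaceTime d => heatKernel q.1 q.2) (t, x) := by
  rcases lt_or_gt_of_ne ht with h | h
  · refine (continuousAt_const (y := (0 : ℝ))).congr ?_
    filter_upwards [(continuous_fst.tendsto (t, x)).eventually (gt_mem_nhds h)] with q hq
    simp [heatKernel, not_lt.2 (le_of_lt hq)]
  · have h1 : ContinuousAt (fun q : SpaceTime d =>
        (4 * Real.pi * q.1) ^ (-(d : ℝ) / 2) * Real.exp (-‖q.2‖ ^ 2 / (4 * q.1))) (t, x) := by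
      refine ContinuousAt.mul ?_ ?_
      · refine ContinuousAt.rpow_const (by fun_prop) (Or.inl ?_)
        have := Real.pi_pos
        positivity
      · refine ContinuousAt.rexp (ContinuousAt.div (by fun_prop) (by fun_prop) ?_)
        simpa using ht
    refine h1.congr ?_
    filter_upwards [(continuous_fst.tendsto (t, x)).eventually (lt_mem_nhds h)] with q hq
    simp [heatKernel, hq]

lemma continuousAt_gKernel {t₀ : ℝ} {x₀ : EuclideanSpace ℝ (Fin d)} {p : SpaceTime d}
    (hp : t₀ ≠ p.1) : ContinuousAt (fun q : SpaceTime d => gKernel q.1 q.2 p) (t₀, x₀) := by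
  refine ContinuousAt.comp (f := fun q : SpaceTime d => ((q.1 - p.1, q.2 - p.2) : SpaceTime d))
    (g := fun q : SpaceTime d => heatKernel q.1 q.2) ?_ (by fun_prop)
  exact continuousAt_heatKernel (sub_ne_zero.2 hp) _

/-- A probability density supported close to `p₀` averages a function continuous at `p₀` to almost
its value there. -/
lemma dist_integral_mul_le {η f : SpaceTime d → ℝ} {p₀ : SpaceTime d} {ε : ℝ}
    (hη0 : ∀ p, 0 ≤ η p) (hη : Integrable η) (hη1 : ∫ p, η p = 1)
    (hηf : Integrable fun p => η p * f p)
    (hε : ∀ p, η p ≠ 0 → dist (f p) (f p₀) ≤ ε) : dist (∫ p, η p * f p) (f p₀) ≤ ε := by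
  have h1 : (∫ p, η p * f p) - f p₀ = ∫ p, η p * (f p - f p₀) := by
    simp_rw [mul_sub]
    rw [integral_sub hηf (hη.mul_const _), integral_mul_const, hη1, one_mul]
  rw [dist_eq_norm, h1]
  calc ‖∫ p, η p * (f p - f p₀)‖ ≤ ∫ p, η p * ε := by
        refine norm_integral_le_of_norm_le (hη.mul_const ε) (ae_of_all _ fun p => ?_)
        rw [norm_mul, Real.norm_of_nonneg (hη0 p)]
        by_cases hp : η p = 0
        · simp [hp]
        · exact mul_le_mul_of_nonneg_left (by rw [← dist_eq_norm]; exact hε p hp) (hη0 p)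
    _ = ε := by rw [integral_mul_const, hη1, one_mul]

/-- If a representing process exists, the heat kernel has finite energy: test the representation on
an approximate identity at an interior point. -/
lemma RepresentsSolution.heatEnergy_lt_top (h : RepresentsSolution H T P F Y)
    (hF : IsFractionalWhiteNoise H T P F) (hH : 1 / 2 < H) (hH' : H < 1) (hT : 0 < T) :
    heatEnergy d H (T / 2) < ∞ := by
  set p₀ : SpaceTime d := (T / 2, 0) with hp₀
  have hball : Metric.closedBall p₀ (T / 4) ⊆ openStrip d T := by
    intro p hp
    have h1 : dist p.1 (T / 2) ≤ T / 4 := (le_max_left _ _).trans (Metric.mem_closedBall.1 hp)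
    rw [Real.dist_eq, abs_le] at h1
    exact ⟨⟨by linarith [h1.1], by linarith [h1.2]⟩, trivial⟩
  have hball' : Metric.closedBall p₀ (T / 4) ⊆ closedStrip d T :=
    hball.trans (prod_mono_left Ioo_subset_Icc_self)
  obtain ⟨C, hC⟩ := h.locally_bounded _ (isCompact_closedBall p₀ (T / 4)) hball'
  -- Bump functions at the centre of the strip, with supports shrinking to the point.
  let φ : ℕ → ContDiffBump p₀ := fun n =>
    ⟨T / 4 / (n + 2), T / 4 / (n + 1), by positivity, by
      apply div_lt_div_of_pos_left <;> first | positivity | linarith⟩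
  have hφle : ∀ n, (φ n).rOut ≤ T / 4 := fun n =>
    div_le_self (by positivity) (by linarith [Nat.cast_nonneg (α := ℝ) n])
  have hts : ∀ n, tsupport ((φ n).normed volume) ⊆ Metric.closedBall p₀ (T / 4) := fun n => by
    rw [(φ n).tsupport_normed_eq]
    exact Metric.closedBall_subset_closedBall (hφle n)
  let η : ℕ → TestFn d T := fun n => ⟨(φ n).normed volume, (φ n).contDiff_normed,
    (φ n).hasCompactSupport_normed, (hts n).trans hball⟩
  have hη0 : ∀ n p, 0 ≤ η n p := fun n p => (φ n).nonneg_normed p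
  have hη1 : ∀ n, ∫ p, η n p = 1 := fun n => (φ n).integral_normed
  have hl1 : ∀ n, ∫⁻ p, ‖η n p‖ₑ = 1 := fun n => by
    rw [← ENNReal.ofReal_one, ← hη1 n, ofReal_integral_eq_lintegral_ofReal (integrable_testFn _)
      (ae_of_all _ (hη0 n))]
    refine lintegral_congr fun p => ?_
    rw [← ofReal_norm, Real.norm_of_nonneg (hη0 n p)]
  have hlim : ∀ p : SpaceTime d, T / 2 ≠ p.1 →
      Tendsto (fun n => ‖convReflected (η n) p‖ₑ) atTop (𝓝 ‖gKernel (T / 2) 0 p‖ₑ) := by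
    intro p hp
    refine Tendsto.enorm ?_
    rw [Metric.tendsto_atTop]
    intro ε hε
    obtain ⟨δ, hδ, hδε⟩ := Metric.continuousAt_iff.1
      (continuousAt_gKernel (x₀ := (0 : EuclideanSpace ℝ (Fin d))) hp) (ε / 2) (by positivity)
    have hr : Tendsto (fun n => (φ n).rOut) atTop (𝓝 0) :=
      tendsto_const_div_atTop_nhds_zero_nat (T / 4) |>.comp (tendsto_add_atTop_nat 1) |>.congr
        fun n => by simp [φ]
    obtain ⟨N, hN⟩ := eventually_atTop.1 (hr.eventually (gt_mem_nhds hδ))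
    refine ⟨N, fun n hn => lt_of_le_of_lt ?_ (half_lt_self hε)⟩
    have h1 : ∀ q, q ∉ closedStrip d T → η n q * gKernel q.1 q.2 p = 0 := fun q hq => by
      rw [testFn_eq_zero (η n) hq, zero_mul]
    rw [convReflected_eq, setIntegral_eq_integral_of_forall_compl_eq_zero h1]
    refine dist_integral_mul_le (f := fun q => gKernel q.1 q.2 p) (p₀ := p₀) (hη0 n)
      (integrable_testFn _) (hη1 n) ((integrableOn_iff_integrable_of_support_subset
        (Function.support_subset_iff'.2 h1)).1 (integrable_testFn_mul_gKernel (η n) p)) ?_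
    intro q hq
    have hq' : q ∈ Metric.ball p₀ (φ n).rOut := by
      rw [← (φ n).support_normed_eq (μ := volume)]
      exact hq
    exact (hδε ((Metric.mem_ball.1 hq').trans (hN n hn))).le
  have hc : ENNReal.ofReal (H * (2 * H - 1)) ≠ 0 :=
    (ENNReal.ofReal_pos.2 (mul_pos (by linarith) (by linarith))).ne'
  have hM : ∀ n, energy H T (fun p => ‖convReflected (η n) p‖ₑ)
      (fun p => ‖convReflected (η n) p‖ₑ) ≤
      2 * ENNReal.ofReal C / ENNReal.ofReal (H * (2 * H - 1)) := by
    intro n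
    rw [ENNReal.le_div_iff_mul_le (Or.inl hc) (Or.inl (by simp)), mul_comm]
    have := h.energy_convReflected_le hF hH hH' (hη0 n) (C := ENNReal.ofReal C)
      fun p hp => hC p (hts n hp)
    rwa [hl1, one_pow, mul_one] at this
  have hfin := energy_le_of_tendsto (T := T) hH hH' (measurable_gKernel (T / 2) 0).enorm
    (fun n => (stronglyMeasurable_convReflected (η n)).measurable.enorm) hlim hM
  rw [energy_gKernel (by linarith)] at hfin
  exact hfin.trans_lt (ENNReal.div_lt_top (ENNReal.mul_ne_top (by simp) (by simp)) hc)

end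

end FracHeat

theorem mainTheorem2 {Ω : Type*} [MeasurableSpace Ω] (P : Measure Ω) [IsProbabilityMeasure P]
    (d : ℕ) (hd : 1 ≤ d) (H T : ℝ) (hH : 1 / 2 < H) (hH' : H < 1) (hT : 0 < T)
    (F : FracHeat.TestFn d T → Ω → ℝ) (hF : FracHeat.IsFractionalWhiteNoise H T P F) :
    -- the distribution-valued solution is well defined
    (∀ η : FracHeat.TestFn d T,
      FracHeat.StochIntegralWellDefined H T P F (FracHeat.convReflected η)) ∧
    -- necessary and sufficient condition
    ((∃ Y : ℝ → EuclideanSpace ℝ (Fin d) → Ω → ℝ, FracHeat.RepresentsSolution H T P F Y) ↔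
      (d : ℝ) / 4 < H) ∧
    ((d : ℝ) / 4 < H → d ≤ 3) ∧
    -- in this case `Y` is a modification of the process solution
    ((d : ℝ) / 4 < H →
      (∀ t ∈ Icc 0 T, ∀ x : EuclideanSpace ℝ (Fin d),
        FracHeat.StochIntegralWellDefined H T P F (FracHeat.gKernel t x)) ∧
      (∃ Y : ℝ → EuclideanSpace ℝ (Fin d) → Ω → ℝ, FracHeat.RepresentsSolution H T P F Y ∧
        ∀ t ∈ Icc 0 T, ∀ x : EuclideanSpace ℝ (Fin d),
          Y t x =ᵐ[P] FracHeat.processSolution H T P F t x) ∧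
      (∀ Y : ℝ → EuclideanSpace ℝ (Fin d) → Ω → ℝ, FracHeat.RepresentsSolution H T P F Y →
        ∀ᵐ p : FracHeat.SpaceTime d ∂(volume.restrict (FracHeat.closedStrip d T)),
          Y p.1 p.2 =ᵐ[P] FracHeat.processSolution H T P F p.1 p.2)) := by
  refine ⟨fun η => FracHeat.stochIntegralWellDefined hF hH hH' (FracHeat.memAbsH_convReflected hH η),
    ⟨?_, ?_⟩, ?_, fun hd4 => ⟨?_, ?_, ?_⟩⟩
  · rintro ⟨Y, hY⟩
    by_contra hd4
    have h1 := hY.heatEnergy_lt_top hF hH hH' hT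
    rw [FracHeat.heatEnergy_eq_top hH' (not_lt.1 hd4) (half_pos hT)] at h1
    exact lt_irrefl _ h1
  · intro hd4
    obtain ⟨Y, hY, hYv⟩ := FracHeat.exists_modification hF hH hH' hd4
    exact ⟨Y, FracHeat.representsSolution_of_modification hF hH hH' hd4 hY hYv⟩
  · intro hd4
    have h1 : (d : ℝ) < 4 := by linarith
    have h2 : d < 4 := by exact_mod_cast h1
    omega
  · exact fun t ht x =>
      FracHeat.stochIntegralWellDefined hF hH hH' (FracHeat.memAbsH_gKernel hH hd4 ht.2 x)
  · obtain ⟨Y, hY, hYv⟩ := FracHeat.exists_modification hF hH hH' hd4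
    exact ⟨Y, FracHeat.representsSolution_of_modification hF hH hH' hd4 hY hYv,
      fun t ht x => hYv (t, x) ⟨ht, trivial⟩⟩
  · intro Y hY
    obtain ⟨Y', hY', hYv⟩ := FracHeat.exists_modification hF hH hH' hd4
    have hr := FracHeat.representsSolution_of_modification hF hH hH' hd4 hY' hYv
    filter_upwards [hY.ae_eq hr, ae_restrict_mem (FracHeat.measurableSet_closedStrip d T)]
      with p hp hpm
    exact hp.trans (hYv p hpm)
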